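/- Let $n\ge 1$ and $N\ge 0$. Let $A\in\mathbb{R}^{n\times n}$ have ones on the superdiagonal and zeros elsewhere, let $B=(0,\dots,0,1)^\top\in\mathbb{R}^n$ and $\eta_1=(1,0,\dots,0)^\top\in\mathbb{R}^n$. Consider agents $\dot x_i=Ax_i+Bu_i$, $i=0,\dots,N$, with a leader $0$, $u_0=0$, and consensus errors $e_i=x_i-x_0$, $e=(e_1^\top,\dots,e_N^\top)^\top\in\mathbb{R}^{Nn}$. The agents communicate over a directed graph on $\{0,\dots,N\}$ without self-loops, in which $(i,j)$ is an edge if $j$ sends information to $i$; the leader receives nothing, and every follower is the end of a directed path starting at the leader. Put $w_{ij}=1$ if $(i,j)$ is an edge and $w_{ij}=0$ otherwise. The transmitted vectors are given by $$v_0=0,\qquad v_i=\frac{1}{\sum_{j=0}^N w_{ij}}\sum_{j=0}^N w_{ij}\,(x_i-x_j+v_j),\quad i=1,\dots,N .$$ Let $\mu\in[-1,0)$, $\lambda>0$, $K_{lin}=\eta_1^\top(A+\lambda I)^n$, $G_{\mathbf d}=\mathrm{diag}\{1-\mu(n-k)\}_{k=1}^n$, $\mathbf d(s)=\exp(sG_{\mathbf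 d})$, and let $H$ be the matrix with rows $h_k=-\eta_1^\top(A+\lambda I)^{k-1}$, $k=1,\dots,n$. Let $P\in\mathbb{R}^{n\times n}$ satisfy (where $\succ 0$, $\prec 0$ mean symmetric and positive, negative definite) $$P\succ0,\qquad PG_{\mathbf d}+G_{\mathbf d}P\succ0,\qquad P(A-BK_{lin})+(A-BK_{lin})^\top P\prec0 ,$$ let $\|z\|_P=\sqrt{z^\top Pz}$, and let $\|\cdot\|_{\mathbf d}$ be the canonical homogeneous norm: $\|0\|_{\mathbf d}=0$ and $\|z\|_{\mathbf d}=e^{s}$ with $\|\mathbf d(-s)z\|_P=1$ for $z\neq0$. Apply the protocol $$u_i=-\|v_i\|_{\mathbf d}^{1+\mu}K_{lin}\,\mathbf d(-\ln\|v_i\|_{\mathbf d})\,v_i,\qquad i=1,\dots,N$$ (with $u_i=0$ where $v_i=0$). Define $$\Sigma=\{e:\eta_1^\top e_i\le0\ \forall i\},\quad \Omega=\{e:He_i\ge0\ \forall i\},\quad \Omega_{\mathbf d}=\{e:H\mathbf d(-\ln\|e_i\|_{\mathbf d})e_i\ge0\ \forall i\},$$ where inequalities between vectors are componentwise and the vector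 in the definition of $\Omega_{\mathbf d}$ is $0$ if $e_i=0$. Solutions of differential equations are understood in the sense of Filippov (these are the classical ones where the right-hand side is continuous). Then: 1. For every $z\ne0$ there is exactly one $s$ with $\|\mathbf d(-s)z\|_P=1$, and for all $x_0,\dots,x_N$ the equations for the transmitted vectors have exactly one solution $(v_0,\dots,v_N)$. 2. The consensus error obeys an autonomous equation $\dot e=f(e)$, $f:\mathbb{R}^{Nn}\to\mathbb{R}^{Nn}$. This equation is globally finite-time stable: from every initial value there is a solution on $[0,\infty)$; the origin is Lyapunov stable; and there is a function $T:\mathbb{R}^{Nn}\to(0,\infty)$ such that every solution satisfies $e(t)=0$ for all $t\ge T(e(0))$. 3. $\Omega_{\mathbf d}$ is a homogeneous cone (it is non-empty, and $(\mathbf d(s)e_i)_i\in\Omega_{\mathbf d}$ for all $e\in\Omega_{\mathbf d}$, $s\in\mathbb{R}$), and it is strictly positively invariant: every solution of $\dot e=f(e)$ with $e(0)\in\Omega_{\mathbf d}$ satisfies $e(t)\in\Omega_{\mathbf d}$ for all $t\ge0$. 4. $\Omega\subset\Sigma$ and $\Omega_{\mathbf d}\subset\Sigma$; and $e(0)\in\Omega_{\mathbf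 d}$ whenever $e(0)\in\Omega$ and $\|e_i(0)\|_P\le1$ for all $i=1,\dots,N$. -/

import Mathlib

open MeasureTheory
open scoped Matrix

namespace NonOvershoot

/-! ### Agent dynamics, communication network, transmitted data -/

/-- The chain-of-integrators matrix: ones on the superdiagonal, zeros elsewhere. -/
def chainA (n : ℕ) : Matrix (Fin n) (Fin n) ℝ :=
  Matrix.of fun i j => if (i : ℕ) + 1 = (j : ℕ) then 1 else 0

/-- The input vector `B = (0, …, 0, 1)ᵀ`. -/
def inputB (n : ℕ) : Fin n → ℝ := fun i => if (i : ℕ) + 1 = n then 1 else 0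

/-- The first vector `η₁ = (1, 0, …, 0)ᵀ` of the canonical basis. -/
def eta1 (n : ℕ) : Fin n → ℝ := fun i => if (i : ℕ) = 0 then 1 else 0

/-- Vertex `0` is the leader, vertices `1, …, N` are the followers, and `G.Adj i j` means that
`(i, j)` is an edge, i.e. that agent `j` transfers its information to agent `i`.  There are no
self-loops, the leader receives nothing, and every follower is the end of a directed path that
starts at the leader. -/
structure IsLeaderFollower {N : ℕ} (G : Digraph (Fin (N + 1))) : Prop where
  no_loop : ∀ i, ¬ G.Adj i i
  leader_source : ∀ j, ¬ G.Adj 0 j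
  reachable : ∀ i, i ≠ 0 → Relation.TransGen (fun j i => G.Adj i j) 0 i

open Classical in
/-- Entries of the adjacency matrix: `w i j = 1` if `(i, j)` is an edge and `0` otherwise. -/
noncomputable def weight {N : ℕ} (G : Digraph (Fin (N + 1))) (i j : Fin (N + 1)) : ℝ :=
  if G.Adj i j then 1 else 0

/-- The implicit equations for the transmitted vectors: `v 0 = 0` and
`v i = (∑ⱼ w i j)⁻¹ ∑ⱼ w i j (x i - x j + v j)` for every follower `i`. -/
def IsTransmitted {N n : ℕ} (G : Digraph (Fin (N + 1)))
    (x v : Fin (N + 1) → Fin n → ℝ) : Prop :=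
  v 0 = 0 ∧ ∀ i, i ≠ 0 →
    v i = (1 / ∑ j, weight G i j) • ∑ j, weight G i j • (x i - x j + v j)

/-! ### The dilation, the canonical homogeneous norm, the protocol -/

/-- The generator `G_d = diag {1 - μ (n - k)}`, `k = 1, …, n`. -/
noncomputable def generator (n : ℕ) (μ : ℝ) : Matrix (Fin n) (Fin n) ℝ :=
  Matrix.diagonal fun k => 1 - μ * ((n : ℝ) - ((k : ℕ) + 1 : ℝ))

/-- The linear dilation `d(s) = exp(s G_d)`. -/
noncomputable def dil (n : ℕ) (μ s : ℝ) : Matrix (Fin n) (Fin n) ℝ :=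
  NormedSpace.exp (s • generator n μ)

/-- The weighted Euclidean norm `‖x‖_P = √(xᵀ P x)`. -/
noncomputable def pNorm {n : ℕ} (P : Matrix (Fin n) (Fin n) ℝ) (x : Fin n → ℝ) : ℝ :=
  Real.sqrt (x ⬝ᵥ (P *ᵥ x))

open Classical in
/-- The canonical homogeneous norm induced by `‖·‖_P`: `‖0‖_d = 0` and `‖x‖_d = exp s` with
`‖d(-s) x‖_P = 1` for `x ≠ 0`. -/
noncomputable def homNorm {n : ℕ} (μ : ℝ) (P : Matrix (Fin n) (Fin n) ℝ) (x : Fin n → ℝ) : ℝ :=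
  if x = 0 then 0
  else Real.exp (Classical.epsilon fun s : ℝ => pNorm P (dil n μ (-s) *ᵥ x) = 1)

/-- The projection `d(-ln ‖x‖_d) x` of `x` to the unit sphere. -/
noncomputable def homProj {n : ℕ} (μ : ℝ) (P : Matrix (Fin n) (Fin n) ℝ) (x : Fin n → ℝ) :
    Fin n → ℝ :=
  dil n μ (-Real.log (homNorm μ P x)) *ᵥ x

/-- The linear gain `K_lin = η₁ᵀ (A + λ I)ⁿ`. -/
noncomputable def gainLin (n : ℕ) (lam : ℝ) : Fin n → ℝ :=
  eta1 n ᵥ* (chainA n + lam • (1 : Matrix (Fin n) (Fin n) ℝ)) ^ n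

/-- The matrix `A - B K_lin`. -/
noncomputable def closedLoopMatrix (n : ℕ) (lam : ℝ) : Matrix (Fin n) (Fin n) ℝ :=
  chainA n - Matrix.vecMulVec (inputB n) (gainLin n lam)

/-- The homogeneous feedback `v ↦ -‖v‖_d ^ (1 + μ) K_lin d(-ln ‖v‖_d) v`. -/
noncomputable def protocol {n : ℕ} (μ lam : ℝ) (P : Matrix (Fin n) (Fin n) ℝ)
    (v : Fin n → ℝ) : ℝ :=
  -(homNorm μ P v ^ (1 + μ) * (gainLin n lam ⬝ᵥ homProj μ P v))

/-- The velocity `A xᵢ + B uᵢ` of agent `i`, with `u₀ = 0` for the leader and the homogeneous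
protocol applied to the transmitted vector for the followers. -/
noncomputable def agentVelocity {N n : ℕ} (μ lam : ℝ) (P : Matrix (Fin n) (Fin n) ℝ)
    (x v : Fin (N + 1) → Fin n → ℝ) (i : Fin (N + 1)) : Fin n → ℝ :=
  chainA n *ᵥ x i + (if i = 0 then 0 else protocol μ lam P (v i)) • inputB n

/-- The consensus error `e i = x i - x 0`, `i = 1, …, N`. -/
def consensusError {N n : ℕ} (x : Fin (N + 1) → Fin n → ℝ) : Fin N → Fin n → ℝ :=
  fun i => x i.succ - x 0

/-- `e' = f e` is the closed-loop error equation: in every state `x` of the network, with the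
transmitted vectors `v` belonging to it, `f` maps the consensus error to the velocity of the
consensus error. -/
def IsErrorField {N n : ℕ} (G : Digraph (Fin (N + 1))) (μ lam : ℝ)
    (P : Matrix (Fin n) (Fin n) ℝ)
    (f : (Fin N → Fin n → ℝ) → (Fin N → Fin n → ℝ)) : Prop :=
  ∀ x v, IsTransmitted G x v →
    f (consensusError x) = consensusError (agentVelocity μ lam P x v)

/-! ### The cones -/

/-- The matrix `H` with rows `h_k = -η₁ᵀ (A + λ I)^(k-1)`, `k = 1, …, n`. -/
noncomputable def matH (n : ℕ) (lam : ℝ) : Matrix (Fin n) (Fin n) ℝ :=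
  Matrix.of fun k => -(eta1 n ᵥ* (chainA n + lam • (1 : Matrix (Fin n) (Fin n) ℝ)) ^ (k : ℕ))

/-- The set `Σ` of errors whose first components are all nonpositive. -/
def setSigma (N n : ℕ) : Set (Fin N → Fin n → ℝ) :=
  {e | ∀ i, eta1 n ⬝ᵥ e i ≤ 0}

/-- The linear cone `Ω = {e : H eᵢ ≥ 0 for all i}`. -/
def coneLin (N n : ℕ) (lam : ℝ) : Set (Fin N → Fin n → ℝ) :=
  {e | ∀ i, 0 ≤ matH n lam *ᵥ e i}

/-- The homogeneous cone `Ω_d = {e : H d(-ln ‖eᵢ‖_d) eᵢ ≥ 0 for all i}`. -/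
def coneHom (N : ℕ) {n : ℕ} (μ lam : ℝ) (P : Matrix (Fin n) (Fin n) ℝ) :
    Set (Fin N → Fin n → ℝ) :=
  {e | ∀ i, 0 ≤ matH n lam *ᵥ homProj μ P (e i)}

/-- A homogeneous cone: a nonempty set invariant under the dilation `e ↦ (d(s) eᵢ)ᵢ`. -/
def IsHomogeneousCone {N n : ℕ} (μ : ℝ) (S : Set (Fin N → Fin n → ℝ)) : Prop :=
  S.Nonempty ∧ ∀ e ∈ S, ∀ s : ℝ, (fun i => dil n μ s *ᵥ e i) ∈ S

/-! ### Solutions, stability, invariance -/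

section ODE

variable {E : Type*} [NormedAddCommGroup E] [NormedSpace ℝ E] [MeasureSpace E]

/-- The Filippov regularization of a vector field:
`F(x) = ⋂_{δ > 0} ⋂_{vol Z = 0} closure (conv f(B(x, δ) \ Z))`. -/
def filippov (f : E → E) (x : E) : Set E :=
  ⋂ (δ : ℝ) (_ : 0 < δ) (Z : Set E) (_ : volume Z = 0),
    closure (convexHull ℝ (f '' (Metric.ball x δ \ Z)))

/-- `x` is a Filippov solution of `x' = f x` on `[0, τ]`: it is absolutely continuous, i.e. the
integral of an integrable function `g`, and its derivative satisfies `g t ∈ F(x t)` for almost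
every `t`.  Where `f` is continuous these are the classical solutions. -/
def IsSolutionOn (f : E → E) (τ : ℝ) (x : ℝ → E) : Prop :=
  ∃ g : ℝ → E, IntervalIntegrable g volume 0 τ ∧
    (∀ᵐ t ∂(volume.restrict (Set.Icc 0 τ)), g t ∈ filippov f (x t)) ∧
    ∀ t ∈ Set.Icc 0 τ, x t = x 0 + ∫ s in (0 : ℝ)..t, g s

/-- Every initial value is the starting point of a solution on `[0, ∞)`. -/
def HasGlobalSolutions (f : E → E) : Prop :=
  ∀ x₀ : E, ∃ x : ℝ → E, x 0 = x₀ ∧ ∀ τ, 0 < τ → IsSolutionOn f τ x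

/-- Lyapunov stability of the origin, for all solutions. -/
def LyapunovStable (f : E → E) : Prop :=
  ∀ ε > 0, ∃ δ > 0, ∀ τ > 0, ∀ x : ℝ → E, IsSolutionOn f τ x → ‖x 0‖ < δ →
    ∀ t ∈ Set.Icc 0 τ, ‖x t‖ < ε

/-- Global finite-time stability: solutions exist globally, the origin is Lyapunov stable, and
there is a settling-time function `T` such that all solutions vanish from time `T (x 0)` on. -/
def GloballyFiniteTimeStable (f : E → E) : Prop :=
  HasGlobalSolutions f ∧ LyapunovStable f ∧
    ∃ T : E → ℝ, (∀ x₀, 0 < T x₀) ∧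
      ∀ τ > 0, ∀ x : ℝ → E, IsSolutionOn f τ x → ∀ t ∈ Set.Icc 0 τ, T (x 0) ≤ t → x t = 0

/-- Positive invariance, for all solutions: `x 0 ∈ S` implies `x t ∈ S` for all `t ≥ 0`. -/
def StrictlyPositivelyInvariant (f : E → E) (S : Set E) : Prop :=
  ∀ τ > 0, ∀ x : ℝ → E, IsSolutionOn f τ x → x 0 ∈ S → ∀ t ∈ Set.Icc 0 τ, x t ∈ S

end ODE

end NonOvershoot

open NonOvershoot

/-!
Because the leader is reachable from every follower, a discrete maximum principle forces the
transmitted vectors to be `v i = x i - x 0 = e i`, so the error equation splits into `N` copies of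
one closed loop `z' = φ z` with the odd homogeneous field `φ = agentField`. In polar coordinates
`z = d(s) y`, `‖y‖_P = 1`, with `M = A - B K_lin`, this loop reads
`s' = e^{μ s} ρ(y)`, `y' = e^{μ s} (M y - ρ(y) G_d y)`, where `ρ < 0` is the quotient of the two
quadratic forms in the matrix inequalities. Hence `‖z‖_d ^ (-μ)` decreases at a rate bounded away
from zero until the solution vanishes. In the coordinates `η = H y` the angular equation has the
matrix `(A - λ I) - ρ H G_d H⁻¹`, whose off-diagonal entries are nonnegative, so the nonnegative
orthant is preserved.

The field is continuous away from `z = 0`, so a component of a Filippov solution is a classical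
solution as long as it does not vanish. Conversely, since `φ` is odd, averaging over the reflection
of the vanishing components shows that `f e` belongs to the Filippov regularization at `e`.
Trajectories are obtained from a smooth angular equation on the compact ellipsoid `‖y‖_P = 1` by a
change of time, which reaches the origin at a finite time.
-/

namespace NonOvershoot

open Set Filter Topology

/-! ### Linear systems with Metzler matrices -/

section Metzler

variable {ι : Type*}

/-- A Metzler matrix, i.e. one with nonnegative off-diagonal entries. These are the matrices whose
flow preserves the nonnegative orthant. -/
def IsMetzler (a : Matrix ι ι ℝ) : Prop := ∀ i j, i ≠ j → 0 ≤ a i j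

lemma IsMetzler.add {a b : Matrix ι ι ℝ} (ha : IsMetzler a) (hb : IsMetzler b) :
    IsMetzler (a + b) :=
  fun i j hij => add_nonneg (ha i j hij) (hb i j hij)

lemma IsMetzler.smul {a : Matrix ι ι ℝ} (ha : IsMetzler a) {c : ℝ} (hc : 0 ≤ c) :
    IsMetzler (c • a) :=
  fun i j hij => mul_nonneg hc (ha i j hij)

lemma hasDerivAt_min_zero_sq (u : ℝ) : HasDerivAt (fun v : ℝ => min v 0 ^ 2) (2 * min u 0) u := by
  have hsq (v : ℝ) : HasDerivAt (fun v : ℝ => v ^ 2) (2 * v) v := by simpa using hasDerivAt_pow 2 v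
  rcases lt_trichotomy u 0 with h | rfl | h
  · rw [min_eq_left h.le]
    refine (hsq u).congr_of_eventuallyEq ?_
    filter_upwards [Iio_mem_nhds h] with v hv
    rw [min_eq_left (le_of_lt hv)]
  · have h0 := hsq 0
    rw [hasDerivAt_iff_isLittleO] at h0 ⊢
    refine (Asymptotics.IsBigO.of_norm_le fun v => ?_).trans_isLittleO h0
    rcases le_total v 0 with hv | hv <;> simp [hv]
  · rw [min_eq_right h.le, mul_zero]
    refine (hasDerivAt_const u (0 : ℝ)).congr_of_eventuallyEq ?_
    filter_upwards [Ioi_mem_nhds h] with v hv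
    simp [min_eq_right (mem_Ioi.1 hv).le]

lemma nonpos_of_hasDerivAt_le_mul {W W' : ℝ → ℝ} {C t₀ t₁ : ℝ} (ht : t₀ ≤ t₁)
    (hc : ContinuousOn W (Icc t₀ t₁)) (hd : ∀ t ∈ Ioo t₀ t₁, HasDerivAt W (W' t) t)
    (hle : ∀ t ∈ Ioo t₀ t₁, W' t ≤ C * W t) (h0 : W t₀ ≤ 0) : W t₁ ≤ 0 := by
  have hexp (t : ℝ) : HasDerivAt (fun t => Real.exp (-C * t)) (Real.exp (-C * t) * -C) t := by
    simpa using ((hasDerivAt_id t).const_mul (-C)).exp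
  have hanti : AntitoneOn (fun t => Real.exp (-C * t) * W t) (Icc t₀ t₁) := by
    refine antitoneOn_of_hasDerivWithinAt_nonpos (convex_Icc _ _)
      (f' := fun t => Real.exp (-C * t) * -C * W t + Real.exp (-C * t) * W' t)
      (ContinuousOn.mul (by fun_prop) hc) ?_ ?_ <;> rw [interior_Icc]
    · exact fun t ht => ((hexp t).mul (hd t ht)).hasDerivWithinAt
    · intro t ht
      nlinarith [hle t ht, Real.exp_pos (-C * t)]
  have h := hanti (left_mem_Icc.2 ht) (right_mem_Icc.2 ht) ht
  refine nonpos_of_mul_nonpos_right (h.trans ?_) (Real.exp_pos _)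
  exact mul_nonpos_of_nonneg_of_nonpos (Real.exp_pos _).le h0

lemma IsMetzler.min_zero_mul_le {a : Matrix ι ι ℝ} (ha : IsMetzler a) {D : ℝ} {i j : ι}
    (hD : |a i j| ≤ D) (z : ι → ℝ) :
    min (z i) 0 * (a i j * z j) ≤ D * ((min (z i) 0 ^ 2 + min (z j) 0 ^ 2) / 2) := by
  have hi : min (z i) 0 ≤ 0 := min_le_right _ _
  have hj : min (z j) 0 ≤ 0 := min_le_right _ _
  have hD₀ : 0 ≤ D := (abs_nonneg _).trans hD
  calc min (z i) 0 * (a i j * z j)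
      ≤ a i j * (min (z i) 0 * min (z j) 0) := by
        by_cases hij : i = j
        · subst hij
          rcases le_total (z i) 0 with h | h
          · rw [min_eq_left h]
            exact le_of_eq (by ring)
          · simp [min_eq_right h]
        · have hj' : min (z j) 0 ≤ z j := min_le_left _ _
          nlinarith [mul_nonneg (ha i j hij) (mul_nonneg (neg_nonneg.2 hi) (sub_nonneg.2 hj'))]
    _ ≤ D * (min (z i) 0 * min (z j) 0) :=
        mul_le_mul_of_nonneg_right (abs_le.1 hD).2 (mul_nonneg_of_nonpos_of_nonpos hi hj)
    _ ≤ D * ((min (z i) 0 ^ 2 + min (z j) 0 ^ 2) / 2) := by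
        gcongr
        nlinarith [sq_nonneg (min (z i) 0 - min (z j) 0)]

variable [Fintype ι]

lemma IsMetzler.sum_min_zero_mul_mulVec_le {a : Matrix ι ι ℝ} (ha : IsMetzler a) {D : ℝ}
    (hD : ∀ i j, |a i j| ≤ D) (z : ι → ℝ) :
    ∑ i, 2 * min (z i) 0 * (a *ᵥ z) i ≤ 2 * (D * Fintype.card ι) * ∑ i, min (z i) 0 ^ 2 :=
  calc ∑ i, 2 * min (z i) 0 * (a *ᵥ z) i
      = ∑ i, ∑ j, 2 * (min (z i) 0 * (a i j * z j)) := by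
        refine Finset.sum_congr rfl fun i _ => ?_
        rw [Matrix.mulVec, dotProduct, Finset.mul_sum]
        exact Finset.sum_congr rfl fun j _ => by ring
    _ ≤ ∑ i, ∑ j, D * (min (z i) 0 ^ 2 + min (z j) 0 ^ 2) := by
        refine Finset.sum_le_sum fun i _ => Finset.sum_le_sum fun j _ => ?_
        linarith [ha.min_zero_mul_le (hD i j) z]
    _ = 2 * (D * Fintype.card ι) * ∑ i, min (z i) 0 ^ 2 := by
        simp only [← Finset.mul_sum, Finset.sum_add_distrib, Finset.sum_const, Finset.card_univ,
          nsmul_eq_mul]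
        ring

lemma nonneg_of_hasDerivAt_metzler {ξ : ℝ → ι → ℝ} {a : ℝ → Matrix ι ι ℝ} {t₀ t₁ : ℝ}
    (ht : t₀ ≤ t₁) (hξ : ContinuousOn ξ (Icc t₀ t₁)) (ha : ContinuousOn a (Icc t₀ t₁))
    (hd : ∀ t ∈ Ioo t₀ t₁, HasDerivAt ξ (a t *ᵥ ξ t) t)
    (hM : ∀ t ∈ Ioo t₀ t₁, IsMetzler (a t)) (h0 : 0 ≤ ξ t₀) : 0 ≤ ξ t₁ := by
  obtain ⟨D, hD⟩ : ∃ D, ∀ t ∈ Icc t₀ t₁, ∀ i j, |a t i j| ≤ D := by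
    obtain ⟨D, hD⟩ := isCompact_Icc.exists_bound_of_continuousOn
      (f := fun t => (fun i j => a t i j : ι → ι → ℝ)) ha
    exact ⟨D, fun t ht i j => (norm_le_pi_norm _ j).trans ((norm_le_pi_norm _ i).trans (hD t ht))⟩
  have hterm : ∀ t ∈ Ioo t₀ t₁, ∀ i, HasDerivAt (fun t => min (ξ t i) 0 ^ 2)
      (2 * min (ξ t i) 0 * (a t *ᵥ ξ t) i) t := fun t ht i =>
    HasDerivAt.comp (h₂ := fun v => min v 0 ^ 2) t (hasDerivAt_min_zero_sq _)
      (hasDerivAt_pi.1 (hd t ht) i)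
  have hW : ∑ i, min (ξ t₁ i) 0 ^ 2 ≤ 0 := by
    refine nonpos_of_hasDerivAt_le_mul (W := fun t => ∑ i, min (ξ t i) 0 ^ 2)
      (W' := fun t => ∑ i, 2 * min (ξ t i) 0 * (a t *ᵥ ξ t) i) ht ?_
      (fun t ht => HasDerivAt.fun_sum fun i _ => hterm t ht i)
      (fun t ht => (hM t ht).sum_min_zero_mul_mulVec_le (hD t (Ioo_subset_Icc_self ht)) (ξ t)) ?_
    · exact continuousOn_finsetSum _ fun i _ =>
        ((continuousOn_pi.1 hξ i).inf continuousOn_const).pow 2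
    · exact (Finset.sum_eq_zero fun i _ => by simpa using h0 i).le
  intro i
  have h := (Finset.sum_eq_zero_iff_of_nonneg fun j _ => sq_nonneg (min (ξ t₁ j) 0)).1
    (hW.antisymm (Finset.sum_nonneg fun j _ => sq_nonneg _)) i (Finset.mem_univ i)
  exact min_eq_right_iff.1 (pow_eq_zero_iff two_ne_zero |>.1 h)

end Metzler

/-! ### Quadratic forms -/

section Quad

variable {ι : Type*} [Fintype ι] {P Q : Matrix ι ι ℝ}

/-- The quadratic form `zᵀ Q z`. -/
def quad (Q : Matrix ι ι ℝ) (z : ι → ℝ) : ℝ := z ⬝ᵥ (Q *ᵥ z)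

lemma quad_pos (hQ : Q.PosDef) {z : ι → ℝ} (hz : z ≠ 0) : 0 < quad Q z := by
  simpa [quad] using hQ.dotProduct_mulVec_pos hz

lemma quad_smul (Q : Matrix ι ι ℝ) (c : ℝ) (z : ι → ℝ) : quad Q (c • z) = c ^ 2 * quad Q z := by
  simp only [quad, Matrix.mulVec_smul, smul_dotProduct, dotProduct_smul, smul_eq_mul]
  ring

lemma quad_zero (Q : Matrix ι ι ℝ) : quad Q 0 = 0 := by simp [quad]

lemma quad_neg (Q : Matrix ι ι ℝ) (z : ι → ℝ) : quad Q (-z) = quad Q z := by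
  simp [quad, Matrix.mulVec_neg]

lemma neg_quad (Q : Matrix ι ι ℝ) (z : ι → ℝ) : quad (-Q) z = -quad Q z := by
  simp [quad, Matrix.neg_mulVec]

lemma contDiff_quad (Q : Matrix ι ι ℝ) {m : WithTop ℕ∞} : ContDiff ℝ m (quad Q) := by
  unfold quad Matrix.mulVec dotProduct
  fun_prop

lemma continuous_quad (Q : Matrix ι ι ℝ) : Continuous (quad Q) :=
  (contDiff_quad Q (m := 0)).continuous

lemma quad_eq_norm_sq_mul (Q : Matrix ι ι ℝ) {z : ι → ℝ} (hz : z ≠ 0) :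
    quad Q z = ‖z‖ ^ 2 * quad Q (‖z‖⁻¹ • z) := by
  rw [← quad_smul, smul_smul, mul_inv_cancel₀ (norm_ne_zero_iff.2 hz), one_smul]

lemma inv_norm_smul_mem_sphere {z : ι → ℝ} (hz : z ≠ 0) :
    ‖z‖⁻¹ • z ∈ Metric.sphere (0 : ι → ℝ) 1 := by
  simp [norm_smul, norm_ne_zero_iff.2 hz]

lemma exists_quad_le (Q : Matrix ι ι ℝ) : ∃ C > 0, ∀ z, quad Q z ≤ C * ‖z‖ ^ 2 := by
  obtain ⟨C, hC⟩ := (isCompact_sphere (0 : ι → ℝ) 1).bddAbove_image (continuous_quad Q).continuousOn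
  refine ⟨max C 1, by positivity, fun z => ?_⟩
  rcases eq_or_ne z 0 with rfl | hz
  · simp [quad_zero]
  · rw [quad_eq_norm_sq_mul Q hz, mul_comm]
    gcongr
    exact (hC (mem_image_of_mem _ (inv_norm_smul_mem_sphere hz))).trans (le_max_left _ _)

lemma exists_le_quad (hQ : Q.PosDef) : ∃ c > 0, ∀ z, c * ‖z‖ ^ 2 ≤ quad Q z := by
  obtain ⟨c, hc, hle⟩ := (isCompact_sphere (0 : ι → ℝ) 1).exists_forall_le'
    (continuous_quad Q).continuousOn fun u hu => quad_pos hQ (ne_zero_of_mem_unit_sphere ⟨u, hu⟩)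
  refine ⟨c, hc, fun z => ?_⟩
  rcases eq_or_ne z 0 with rfl | hz
  · simp [quad_zero]
  · rw [quad_eq_norm_sq_mul Q hz, mul_comm]
    gcongr
    exact hle _ (inv_norm_smul_mem_sphere hz)

lemma exists_norm_le_of_quad_eq_one (hQ : Q.PosDef) : ∃ C > 0, ∀ z, quad Q z = 1 → ‖z‖ ≤ C := by
  obtain ⟨c, hc, hle⟩ := exists_le_quad hQ
  refine ⟨1 / c + 1, by positivity, fun z hz => ?_⟩
  have hsq : ‖z‖ ^ 2 ≤ 1 / c := by
    rw [le_div_iff₀' hc, ← hz]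
    exact hle z
  nlinarith [sq_nonneg (‖z‖ - 1)]

lemma exists_quad_le_quad (hQ : Q.PosDef) (P : Matrix ι ι ℝ) :
    ∃ c > 0, ∀ z, c * quad P z ≤ quad Q z := by
  obtain ⟨c, hc, hQc⟩ := exists_le_quad hQ
  obtain ⟨C, hC, hPC⟩ := exists_quad_le P
  refine ⟨c / C, by positivity, fun z => le_trans ?_ (hQc z)⟩
  rw [div_mul_eq_mul_div, div_le_iff₀ hC]
  nlinarith [hPC z]

lemma hasDerivAt_mulVec (M : Matrix ι ι ℝ) {x : ℝ → ι → ℝ} {x' : ι → ℝ} {t : ℝ}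
    (hx : HasDerivAt x x' t) : HasDerivAt (fun t => M *ᵥ x t) (M *ᵥ x') t :=
  M.mulVecLin.toContinuousLinearMap.hasFDerivAt.comp_hasDerivAt t hx

lemma hasDerivAt_quad (Q : Matrix ι ι ℝ) {x : ℝ → ι → ℝ} {x' : ι → ℝ} {t : ℝ}
    (hx : HasDerivAt x x' t) :
    HasDerivAt (fun t => quad Q (x t)) (x' ⬝ᵥ (Q *ᵥ x t) + x t ⬝ᵥ (Q *ᵥ x')) t := by
  simpa only [quad, dotProduct, Finset.sum_add_distrib] using HasDerivAt.fun_sum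
    (u := Finset.univ) fun i _ => (hasDerivAt_pi.1 hx i).fun_mul
      (hasDerivAt_pi.1 (hasDerivAt_mulVec Q hx) i)

lemma mulVec_dotProduct_add_dotProduct_mulVec (Q M : Matrix ι ι ℝ) (z : ι → ℝ) :
    (M *ᵥ z) ⬝ᵥ (Q *ᵥ z) + z ⬝ᵥ (Q *ᵥ (M *ᵥ z)) = quad (Q * M + Mᵀ * Q) z := by
  rw [quad, Matrix.add_mulVec, dotProduct_add, ← Matrix.mulVec_mulVec, ← Matrix.mulVec_mulVec,
    add_comm, Matrix.dotProduct_mulVec z Mᵀ, Matrix.vecMul_transpose]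

end Quad

/-! ### The dilation and the chain of integrators -/

section Chain

variable {n : ℕ} (μ lam : ℝ)

/-- The weights of the dilation, i.e. the diagonal entries of `generator n μ`. The paper's index
`k = 1, …, n` is `k + 1` here. -/
noncomputable def dilWeight (n : ℕ) (μ : ℝ) (k : Fin n) : ℝ :=
  1 - μ * ((n : ℝ) - ((k : ℕ) + 1 : ℝ))

variable {μ} in
lemma one_le_dilWeight (hμ : μ ≤ 0) (k : Fin n) : 1 ≤ dilWeight n μ k := by
  have hk : ((k : ℕ) : ℝ) + 1 ≤ n := by exact_mod_cast k.2
  unfold dilWeight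
  nlinarith

lemma generator_mulVec_apply (z : Fin n → ℝ) (k : Fin n) :
    (generator n μ *ᵥ z) k = dilWeight n μ k * z k := by
  simp [generator, Matrix.mulVec_diagonal, dilWeight]

lemma dil_mulVec_apply (s : ℝ) (z : Fin n → ℝ) (k : Fin n) :
    (dil n μ s *ᵥ z) k = Real.exp (s * dilWeight n μ k) * z k := by
  rw [dil, generator, ← Matrix.diagonal_smul, Matrix.exp_diagonal, Matrix.mulVec_diagonal,
    Pi.coe_exp, Real.exp_eq_exp_ℝ]
  rfl

lemma dil_add_mulVec (s t : ℝ) (z : Fin n → ℝ) :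
    dil n μ (s + t) *ᵥ z = dil n μ s *ᵥ (dil n μ t *ᵥ z) := by
  ext k
  simp only [dil_mulVec_apply, add_mul, Real.exp_add, mul_assoc]

lemma dil_zero_mulVec (z : Fin n → ℝ) : dil n μ 0 *ᵥ z = z := by
  ext k
  simp [dil_mulVec_apply]

variable {μ} in
lemma dil_mulVec_eq_zero {s : ℝ} {z : Fin n → ℝ} : dil n μ s *ᵥ z = 0 ↔ z = 0 := by
  simp [funext_iff, dil_mulVec_apply, Real.exp_ne_zero]

variable {μ} in
lemma norm_dil_mulVec_le (hμ : μ ≤ 0) {s : ℝ} (hs : s ≤ 0) (z : Fin n → ℝ) :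
    ‖dil n μ s *ᵥ z‖ ≤ Real.exp s * ‖z‖ := by
  refine (pi_norm_le_iff_of_nonneg (by positivity)).2 fun k => ?_
  rw [dil_mulVec_apply, norm_mul, Real.norm_of_nonneg (Real.exp_pos _).le]
  gcongr
  · nlinarith [one_le_dilWeight hμ k]
  · exact norm_le_pi_norm z k

variable {μ} in
lemma hasDerivAt_dil_mulVec {s : ℝ → ℝ} {x : ℝ → Fin n → ℝ} {s' : ℝ} {x' : Fin n → ℝ} {t : ℝ}
    (hs : HasDerivAt s s' t) (hx : HasDerivAt x x' t) :
    HasDerivAt (fun t => dil n μ (s t) *ᵥ x t)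
      (dil n μ (s t) *ᵥ x' + s' • (generator n μ *ᵥ (dil n μ (s t) *ᵥ x t))) t := by
  refine hasDerivAt_pi.2 fun k => ?_
  have hexp : HasDerivAt (fun t => Real.exp (s t * dilWeight n μ k))
      (Real.exp (s t * dilWeight n μ k) * (s' * dilWeight n μ k)) t := (hs.mul_const _).exp
  simp only [dil_mulVec_apply, Pi.add_apply, Pi.smul_apply, generator_mulVec_apply, smul_eq_mul]
  exact (hexp.fun_mul (hasDerivAt_pi.1 hx k)).congr_deriv (by ring)

lemma contDiff_dil_mulVec {m : WithTop ℕ∞} :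
    ContDiff ℝ m fun q : (Fin n → ℝ) × ℝ => dil n μ q.2 *ᵥ q.1 := by
  rw [contDiff_pi]
  intro k
  simp only [dil_mulVec_apply]
  fun_prop

lemma generator_transpose : (generator n μ)ᵀ = generator n μ :=
  Matrix.diagonal_transpose _

lemma dil_mulVec_generator (s : ℝ) (z : Fin n → ℝ) :
    dil n μ s *ᵥ (generator n μ *ᵥ z) = generator n μ *ᵥ (dil n μ s *ᵥ z) := by
  ext k
  simp only [dil_mulVec_apply, generator_mulVec_apply, mul_left_comm]

lemma chainA_mulVec_apply (z : Fin n → ℝ) (k : Fin n) :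
    (chainA n *ᵥ z) k = if h : (k : ℕ) + 1 < n then z ⟨k + 1, h⟩ else 0 := by
  simp only [Matrix.mulVec, dotProduct, chainA, Matrix.of_apply, ite_mul, one_mul, zero_mul]
  split_ifs with h
  · rw [Finset.sum_eq_single ⟨k + 1, h⟩ (fun j _ hj => if_neg fun h' => hj (Fin.ext h'.symm))
      (by simp), if_pos rfl]
  · exact Finset.sum_eq_zero fun j _ => if_neg (by omega)

lemma chainA_mulVec_dil (s : ℝ) (z : Fin n → ℝ) :
    chainA n *ᵥ (dil n μ s *ᵥ z) = Real.exp (μ * s) • dil n μ s *ᵥ (chainA n *ᵥ z) := by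
  ext k
  simp only [Pi.smul_apply, dil_mulVec_apply, chainA_mulVec_apply, smul_eq_mul]
  split_ifs with h
  · rw [← mul_assoc, ← Real.exp_add]
    congr 2
    simp only [dilWeight]
    push_cast
    ring
  · simp

lemma dil_mulVec_inputB (n : ℕ) (s : ℝ) : dil n μ s *ᵥ inputB n = Real.exp s • inputB n := by
  ext k
  simp only [Pi.smul_apply, dil_mulVec_apply, inputB, smul_eq_mul]
  split_ifs with h
  · have hk : ((k : ℕ) : ℝ) + 1 = n := by exact_mod_cast h
    simp [dilWeight, hk]
  · simp

lemma chainA_mulVec_generator (z : Fin n → ℝ) :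
    chainA n *ᵥ (generator n μ *ᵥ z) =
      generator n μ *ᵥ (chainA n *ᵥ z) + μ • (chainA n *ᵥ z) := by
  ext k
  simp only [Pi.add_apply, Pi.smul_apply, generator_mulVec_apply, chainA_mulVec_apply, smul_eq_mul]
  split_ifs with h
  · simp only [dilWeight]
    push_cast
    ring
  · simp

lemma closedLoopMatrix_mulVec (z : Fin n → ℝ) :
    closedLoopMatrix n lam *ᵥ z = chainA n *ᵥ z - (gainLin n lam ⬝ᵥ z) • inputB n := by
  simp [closedLoopMatrix, Matrix.sub_mulVec, Matrix.vecMulVec_mulVec]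

/-- The shifted chain `A + λ I`. -/
noncomputable abbrev shiftedChain (n : ℕ) (lam : ℝ) : Matrix (Fin n) (Fin n) ℝ :=
  chainA n + lam • (1 : Matrix (Fin n) (Fin n) ℝ)

/-- The row vector `η₁ᵀ (A + λ I)^m`. The rows of `-matH n lam` are `chainRow n lam 0, …,
chainRow n lam (n - 1)`, and `chainRow n lam n` is the gain. -/
noncomputable def chainRow (n : ℕ) (lam : ℝ) (m : ℕ) : Fin n → ℝ :=
  eta1 n ᵥ* shiftedChain n lam ^ m

lemma matH_mulVec_apply (z : Fin n → ℝ) (k : Fin n) :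
    (matH n lam *ᵥ z) k = -(chainRow n lam k ⬝ᵥ z) :=
  neg_dotProduct _ _

lemma eta1_dotProduct (hn : 0 < n) (z : Fin n → ℝ) : eta1 n ⬝ᵥ z = z ⟨0, hn⟩ := by
  simp only [dotProduct, eta1, ite_mul, one_mul, zero_mul]
  rw [Finset.sum_eq_single ⟨0, hn⟩ (fun j _ hj => if_neg fun h => hj (Fin.ext h)) (by simp),
    if_pos rfl]

lemma shiftedChain_mulVec (z : Fin n → ℝ) :
    shiftedChain n lam *ᵥ z = chainA n *ᵥ z + lam • z := by
  simp [shiftedChain, Matrix.add_mulVec, Matrix.smul_mulVec]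

lemma chainRow_zero : chainRow n lam 0 = eta1 n := by
  simp [chainRow]

lemma chainRow_succ_dotProduct (m : ℕ) (z : Fin n → ℝ) :
    chainRow n lam (m + 1) ⬝ᵥ z = chainRow n lam m ⬝ᵥ (shiftedChain n lam *ᵥ z) := by
  rw [chainRow, pow_succ, ← Matrix.vecMul_vecMul, ← Matrix.dotProduct_mulVec, chainRow]

lemma chainRow_dotProduct_chainA (m : ℕ) (z : Fin n → ℝ) :
    chainRow n lam m ⬝ᵥ (chainA n *ᵥ z) =
      chainRow n lam (m + 1) ⬝ᵥ z - lam * (chainRow n lam m ⬝ᵥ z) := by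
  rw [chainRow_succ_dotProduct, shiftedChain_mulVec, dotProduct_add, dotProduct_smul, smul_eq_mul,
    add_sub_cancel_right]

lemma chainRow_dotProduct_of_forall_lt {m : ℕ} (hm : m < n) (z : Fin n → ℝ)
    (hz : ∀ j : Fin n, (j : ℕ) < m → z j = 0) : chainRow n lam m ⬝ᵥ z = z ⟨m, hm⟩ := by
  induction m generalizing z with
  | zero => rw [chainRow_zero, eta1_dotProduct hm]
  | succ m ih =>
    rw [chainRow_succ_dotProduct, ih (by omega), shiftedChain_mulVec]
    · simp [chainA_mulVec_apply, hm, hz ⟨m, by omega⟩]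
    · intro j hj
      have hj' : (j : ℕ) + 1 < n := by omega
      rw [shiftedChain_mulVec]
      simp [chainA_mulVec_apply, hj', hz j (by omega), hz ⟨j + 1, hj'⟩ (by simpa using hj)]

lemma chainRow_dotProduct_inputB {m : ℕ} (hm : m < n) :
    chainRow n lam m ⬝ᵥ inputB n = if m + 1 = n then 1 else 0 := by
  rw [chainRow_dotProduct_of_forall_lt lam hm, inputB]
  intro j hj
  rw [inputB, if_neg]
  omega

-- For `m = 0` the truncated index `m - 1` is harmless, since its coefficient vanishes.
lemma chainRow_dotProduct_generator (hn : 0 < n) (m : ℕ) (z : Fin n → ℝ) :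
    chainRow n lam m ⬝ᵥ (generator n μ *ᵥ z) =
      (1 - μ * ((n : ℝ) - (m + 1))) * (chainRow n lam m ⬝ᵥ z)
        - m * μ * lam * (chainRow n lam (m - 1) ⬝ᵥ z) := by
  induction m generalizing z with
  | zero => simp [chainRow_zero, eta1_dotProduct hn, generator_mulVec_apply, dilWeight]
  | succ m ih =>
    have hcomm : shiftedChain n lam *ᵥ (generator n μ *ᵥ z) =
        generator n μ *ᵥ (shiftedChain n lam *ᵥ z) + μ • (shiftedChain n lam *ᵥ z)
          - (μ * lam) • z := by
      simp only [shiftedChain_mulVec, chainA_mulVec_generator, Matrix.mulVec_add,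
        Matrix.mulVec_smul, smul_add, smul_smul]
      abel
    rw [chainRow_succ_dotProduct, hcomm]
    simp only [dotProduct_sub, dotProduct_add, dotProduct_smul, smul_eq_mul, ih,
      ← chainRow_succ_dotProduct, Nat.add_sub_cancel]
    rcases m with _ | m <;> push_cast [Nat.add_sub_cancel] <;> ring

/-- The chain `A - λ I`, which is the closed loop in the coordinates `H z`. -/
noncomputable def closedLoopH (n : ℕ) (lam : ℝ) : Matrix (Fin n) (Fin n) ℝ :=
  chainA n - lam • (1 : Matrix (Fin n) (Fin n) ℝ)

lemma matH_mulVec_closedLoopMatrix (z : Fin n → ℝ) :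
    matH n lam *ᵥ (closedLoopMatrix n lam *ᵥ z) = closedLoopH n lam *ᵥ (matH n lam *ᵥ z) := by
  ext k
  have hk := k.2
  have hgain : gainLin n lam = chainRow n lam n := rfl
  simp only [closedLoopH, Matrix.sub_mulVec, Pi.sub_apply, chainA_mulVec_apply,
    closedLoopMatrix_mulVec, Matrix.smul_mulVec, Matrix.one_mulVec, Pi.smul_apply, smul_eq_mul,
    matH_mulVec_apply, dotProduct_sub, dotProduct_smul, chainRow_dotProduct_chainA,
    chainRow_dotProduct_inputB lam hk, hgain]
  by_cases h : (k : ℕ) + 1 = n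
  · simp [h]
  · simp [h, (by omega : (k : ℕ) + 1 < n)]
    ring

/-- The generator of the dilation in the coordinates `H z`, i.e. `H G_d H⁻¹`. -/
noncomputable def generatorH (n : ℕ) (μ lam : ℝ) : Matrix (Fin n) (Fin n) ℝ :=
  generator n μ + Matrix.of fun k j : Fin n =>
    if (j : ℕ) + 1 = (k : ℕ) then -((k : ℕ) : ℝ) * μ * lam else 0

lemma generatorH_mulVec_apply (w : Fin n → ℝ) (k : Fin n) :
    (generatorH n μ lam *ᵥ w) k =
      dilWeight n μ k * w k - k * μ * lam * w ⟨k - 1, (Nat.sub_le _ _).trans_lt k.2⟩ := by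
  rw [generatorH, Matrix.add_mulVec, Pi.add_apply, generator_mulVec_apply, sub_eq_add_neg]
  congr 1
  simp only [Matrix.mulVec, dotProduct, Matrix.of_apply, ite_mul, zero_mul]
  obtain ⟨_ | k, hk⟩ := k
  · simp
  · rw [Finset.sum_eq_single ⟨k, by omega⟩
      (fun j _ hj => if_neg fun h => hj (Fin.ext (by simpa using h))) (by simp), if_pos rfl]
    simp only [Nat.add_sub_cancel, neg_mul]

lemma matH_mulVec_generator (z : Fin n → ℝ) :
    matH n lam *ᵥ (generator n μ *ᵥ z) = generatorH n μ lam *ᵥ (matH n lam *ᵥ z) := by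
  ext k
  rw [generatorH_mulVec_apply, matH_mulVec_apply, matH_mulVec_apply, matH_mulVec_apply,
    chainRow_dotProduct_generator μ lam k.pos, dilWeight]
  ring

variable {μ lam}

lemma isMetzler_closedLoopH : IsMetzler (closedLoopH n lam) := by
  intro i j hij
  simp only [closedLoopH, chainA, Matrix.sub_apply, Matrix.smul_apply, Matrix.one_apply_ne hij,
    Matrix.of_apply]
  split_ifs <;> simp

lemma isMetzler_generatorH (hμ : μ ≤ 0) (hlam : 0 ≤ lam) : IsMetzler (generatorH n μ lam) := by
  intro i j hij
  simp only [generatorH, generator, Matrix.add_apply, Matrix.diagonal_apply_ne _ hij,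
    Matrix.of_apply, zero_add]
  split_ifs
  · rw [mul_assoc, neg_mul_comm, ← neg_mul]
    exact mul_nonneg (Nat.cast_nonneg _) (mul_nonneg (neg_nonneg.2 hμ) hlam)
  · exact le_rfl

end Chain

/-! ### The canonical homogeneous norm -/

lemma contDiffAt_of_implicit {E : Type*} [NormedAddCommGroup E] [NormedSpace ℝ E] [CompleteSpace E]
    {F : E × ℝ → ℝ} {g : E → ℝ} {z : E} {F' : ℝ} {m : WithTop ℕ∞} (hm : m ≠ 0)
    (hF : ContDiffAt ℝ m F (z, g z)) (hF' : HasDerivAt (fun s => F (z, s)) F' (g z))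
    (h0 : F' ≠ 0) (hg : ∀ w s, F (w, s) = F (z, g z) → g w = s) : ContDiffAt ℝ m g z := by
  have hpartial : (fderiv ℝ F (z, g z) ∘L .inr ℝ E ℝ) 1 = F' :=
    ((hF.differentiableAt hm).hasFDerivAt.comp_hasDerivAt (g z)
      ((hasDerivAt_const _ z).prodMk (hasDerivAt_id _))).unique hF'
  have hinv : (fderiv ℝ F (z, g z) ∘L .inr ℝ E ℝ).IsInvertible := by
    refine ⟨ContinuousLinearEquiv.smulLeft (Units.mk0 F' h0), ?_⟩
    ext
    simp [← hpartial]
  refine (hF.contDiffAt_implicitFunction hm hinv).congr_of_eventuallyEq ?_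
  filter_upwards [hF.eventually_apply_implicitFunction hm hinv] with w hw
  exact hg w _ hw

section HomogeneousNorm

variable {n : ℕ} {μ : ℝ} {P : Matrix (Fin n) (Fin n) ℝ}

/-- The hypotheses under which the canonical homogeneous norm is well defined and smooth: `P` is
positive definite and the dilation is monotone with respect to `‖·‖_P`. -/
structure IsMonotoneDilation (μ : ℝ) (P : Matrix (Fin n) (Fin n) ℝ) : Prop where
  posDef : P.PosDef
  posDef_generator : (P * generator n μ + generator n μ * P).PosDef

/-- The radial coordinate `s = ln ‖z‖_d` of `z = d(s) y`, `‖y‖_P = 1`; the angular coordinate `y`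
is `homProj μ P z`. -/
noncomputable def homLog (μ : ℝ) (P : Matrix (Fin n) (Fin n) ℝ) (z : Fin n → ℝ) : ℝ :=
  Real.log (homNorm μ P z)

lemma homProj_eq (z : Fin n → ℝ) : homProj μ P z = dil n μ (-homLog μ P z) *ᵥ z := rfl

lemma homProj_zero : homProj μ P (0 : Fin n → ℝ) = 0 := by simp [homProj]

lemma homProj_ne_zero {z : Fin n → ℝ} (hz : z ≠ 0) : homProj μ P z ≠ 0 :=
  dil_mulVec_eq_zero.not.2 hz

lemma dil_homLog_homProj (z : Fin n → ℝ) : dil n μ (homLog μ P z) *ᵥ homProj μ P z = z := by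
  rw [homProj_eq, ← dil_add_mulVec, add_neg_cancel, dil_zero_mulVec]

lemma homNorm_zero : homNorm μ P (0 : Fin n → ℝ) = 0 := by simp [homNorm]

lemma homNorm_pos {z : Fin n → ℝ} (hz : z ≠ 0) : 0 < homNorm μ P z := by
  rw [homNorm, if_neg hz]
  exact Real.exp_pos _

lemma homNorm_nonneg (z : Fin n → ℝ) : 0 ≤ homNorm μ P z := by
  rcases eq_or_ne z 0 with rfl | hz
  · rw [homNorm_zero]
  · exact (homNorm_pos hz).le

lemma homNorm_eq_exp {z : Fin n → ℝ} (hz : z ≠ 0) : homNorm μ P z = Real.exp (homLog μ P z) := by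
  rw [homLog, Real.exp_log (homNorm_pos hz)]

lemma pNorm_eq_one_iff {z : Fin n → ℝ} : pNorm P z = 1 ↔ quad P z = 1 := by
  rw [pNorm, Real.sqrt_eq_one, quad]

lemma hasDerivAt_quad_dil (z : Fin n → ℝ) (s : ℝ) :
    HasDerivAt (fun s => quad P (dil n μ (-s) *ᵥ z))
      (-quad (P * generator n μ + generator n μ * P) (dil n μ (-s) *ᵥ z)) s := by
  have hG := mulVec_dotProduct_add_dotProduct_mulVec P (generator n μ) (dil n μ (-s) *ᵥ z)
  rw [generator_transpose] at hG
  refine (hasDerivAt_quad P (hasDerivAt_dil_mulVec (hasDerivAt_neg s)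
    (hasDerivAt_const s z))).congr_deriv ?_
  rw [← hG]
  simp only [Matrix.mulVec_zero, zero_add, neg_smul, one_smul, Matrix.mulVec_neg, neg_dotProduct,
    dotProduct_neg]
  ring

namespace IsMonotoneDilation

lemma exists_antitone_exp_mul_quad_dil (h : IsMonotoneDilation μ P) :
    ∃ c > 0, ∀ z, Antitone fun s => Real.exp (c * s) * quad P (dil n μ (-s) *ᵥ z) := by
  obtain ⟨c, hc, hle⟩ := exists_quad_le_quad h.posDef_generator P
  have hexp (s : ℝ) : HasDerivAt (fun s => Real.exp (c * s)) (Real.exp (c * s) * c) s := by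
    simpa using ((hasDerivAt_id s).const_mul c).exp
  refine ⟨c, hc, fun z => antitone_of_hasDerivAt_nonpos
    (fun s => (hexp s).fun_mul (hasDerivAt_quad_dil z s)) fun s => ?_⟩
  simp only [Pi.zero_apply]
  nlinarith [hle (dil n μ (-s) *ᵥ z), Real.exp_pos (c * s)]

lemma strictAnti_quad_dil (h : IsMonotoneDilation μ P) {z : Fin n → ℝ} (hz : z ≠ 0) :
    StrictAnti fun s => quad P (dil n μ (-s) *ᵥ z) :=
  strictAnti_of_hasDerivAt_neg (hasDerivAt_quad_dil z) fun _ =>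
    neg_lt_zero.2 (quad_pos h.posDef_generator (dil_mulVec_eq_zero.not.2 hz))

lemma tendsto_quad_dil_atTop (h : IsMonotoneDilation μ P) {z : Fin n → ℝ} (hz : z ≠ 0) :
    Tendsto (fun s => quad P (dil n μ (-s) *ᵥ z)) atTop (𝓝 0) := by
  obtain ⟨c, hc, hanti⟩ := h.exists_antitone_exp_mul_quad_dil
  have hexp : Tendsto (fun s => quad P z / Real.exp (c * s)) atTop (𝓝 0) :=
    tendsto_const_nhds.div_atTop (Real.tendsto_exp_atTop.comp (tendsto_id.const_mul_atTop hc))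
  refine squeeze_zero' (Eventually.of_forall fun s =>
    (quad_pos h.posDef (dil_mulVec_eq_zero.not.2 hz)).le) ?_ hexp
  filter_upwards [eventually_ge_atTop 0] with s hs
  rw [le_div_iff₀' (Real.exp_pos _)]
  simpa [dil_zero_mulVec] using hanti z hs

lemma tendsto_quad_dil_atBot (h : IsMonotoneDilation μ P) {z : Fin n → ℝ} (hz : z ≠ 0) :
    Tendsto (fun s => quad P (dil n μ (-s) *ᵥ z)) atBot atTop := by
  obtain ⟨c, hc, hanti⟩ := h.exists_antitone_exp_mul_quad_dil
  have hexp : Tendsto (fun s => Real.exp (-(c * s)) * quad P z) atBot atTop :=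
    (Real.tendsto_exp_atTop.comp (tendsto_neg_atBot_atTop.comp
      (tendsto_id.const_mul_atBot hc))).atTop_mul_const (quad_pos h.posDef hz)
  refine tendsto_atTop_mono' _ ?_ hexp
  filter_upwards [eventually_le_atBot 0] with s hs
  rw [Real.exp_neg, inv_mul_le_iff₀ (Real.exp_pos _)]
  simpa [dil_zero_mulVec] using hanti z hs

lemma existsUnique_pNorm_dil_eq_one (h : IsMonotoneDilation μ P) {z : Fin n → ℝ} (hz : z ≠ 0) :
    ∃! s : ℝ, pNorm P (dil n μ (-s) *ᵥ z) = 1 := by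
  simp only [pNorm_eq_one_iff]
  have hcont : Continuous fun s => quad P (dil n μ (-s) *ᵥ z) :=
    continuous_iff_continuousAt.2 fun s => (hasDerivAt_quad_dil z s).continuousAt
  obtain ⟨s, hs⟩ := mem_range_of_exists_le_of_exists_ge hcont
    ((h.tendsto_quad_dil_atTop hz).eventually_le_const one_pos).exists
    ((h.tendsto_quad_dil_atBot hz).eventually_ge_atTop 1).exists
  exact ⟨s, hs, fun s' hs' => (h.strictAnti_quad_dil hz).injective (hs'.trans hs.symm)⟩

lemma quad_homProj (h : IsMonotoneDilation μ P) {z : Fin n → ℝ} (hz : z ≠ 0) :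
    quad P (homProj μ P z) = 1 := by
  rw [← pNorm_eq_one_iff, homProj, homNorm, if_neg hz, Real.log_exp]
  exact Classical.epsilon_spec (p := fun s : ℝ => pNorm P (dil n μ (-s) *ᵥ z) = 1)
    (h.existsUnique_pNorm_dil_eq_one hz).exists

lemma homLog_eq_of_quad_dil_eq_one (h : IsMonotoneDilation μ P) {z : Fin n → ℝ} {s : ℝ}
    (hs : quad P (dil n μ (-s) *ᵥ z) = 1) : homLog μ P z = s := by
  have hz : z ≠ 0 := by
    rintro rfl
    simp [quad_zero] at hs
  exact (h.strictAnti_quad_dil hz).injective ((h.quad_homProj hz).trans hs.symm)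

lemma homLog_le_iff (h : IsMonotoneDilation μ P) {z : Fin n → ℝ} (hz : z ≠ 0) {s : ℝ} :
    homLog μ P z ≤ s ↔ quad P (dil n μ (-s) *ᵥ z) ≤ 1 := by
  rw [← h.quad_homProj hz]
  exact (h.strictAnti_quad_dil hz).le_iff_ge.symm

lemma homLog_dil (h : IsMonotoneDilation μ P) {z : Fin n → ℝ} (hz : z ≠ 0) (s : ℝ) :
    homLog μ P (dil n μ s *ᵥ z) = s + homLog μ P z := by
  refine h.homLog_eq_of_quad_dil_eq_one ?_
  rw [← dil_add_mulVec, neg_add_rev, neg_add_cancel_right]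
  exact h.quad_homProj hz

lemma homProj_dil (h : IsMonotoneDilation μ P) (z : Fin n → ℝ) (s : ℝ) :
    homProj μ P (dil n μ s *ᵥ z) = homProj μ P z := by
  rcases eq_or_ne z 0 with rfl | hz
  · simp
  · rw [homProj_eq, homProj_eq, h.homLog_dil hz, ← dil_add_mulVec, neg_add_rev,
      neg_add_cancel_right]

lemma homLog_neg (h : IsMonotoneDilation μ P) (z : Fin n → ℝ) :
    homLog μ P (-z) = homLog μ P z := by
  rcases eq_or_ne z 0 with rfl | hz
  · simp
  · refine h.homLog_eq_of_quad_dil_eq_one ?_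
    rw [Matrix.mulVec_neg, quad_neg]
    exact h.quad_homProj hz

lemma homNorm_neg (h : IsMonotoneDilation μ P) (z : Fin n → ℝ) :
    homNorm μ P (-z) = homNorm μ P z := by
  rcases eq_or_ne z 0 with rfl | hz
  · simp
  · rw [homNorm_eq_exp hz, homNorm_eq_exp (neg_ne_zero.2 hz), h.homLog_neg]

lemma homProj_neg (h : IsMonotoneDilation μ P) (z : Fin n → ℝ) :
    homProj μ P (-z) = -homProj μ P z := by
  rw [homProj_eq, homProj_eq, h.homLog_neg, Matrix.mulVec_neg]

lemma contDiffAt_homLog (h : IsMonotoneDilation μ P) {z : Fin n → ℝ} (hz : z ≠ 0) :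
    ContDiffAt ℝ 1 (homLog μ P) z := by
  have hF : ContDiff ℝ 1 fun q : (Fin n → ℝ) × ℝ => quad P (dil n μ (-q.2) *ᵥ q.1) :=
    (contDiff_quad P).comp ((contDiff_dil_mulVec μ).comp (contDiff_fst.prodMk contDiff_snd.neg))
  exact contDiffAt_of_implicit one_ne_zero hF.contDiffAt (hasDerivAt_quad_dil z _)
    (neg_ne_zero.2 (quad_pos h.posDef_generator (dil_mulVec_eq_zero.not.2 hz)).ne')
    fun w s hs => h.homLog_eq_of_quad_dil_eq_one (hs.trans (h.quad_homProj hz))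

lemma continuousOn_homLog (h : IsMonotoneDilation μ P) : ContinuousOn (homLog μ P) {0}ᶜ :=
  fun _ hz => (h.contDiffAt_homLog hz).continuousAt.continuousWithinAt

lemma continuousOn_homProj (h : IsMonotoneDilation μ P) : ContinuousOn (homProj μ P) {0}ᶜ :=
  (contDiff_dil_mulVec μ (m := 0)).continuous.comp_continuousOn
    (continuousOn_id.prodMk h.continuousOn_homLog.neg)

lemma continuousAt_homNorm_zero (h : IsMonotoneDilation μ P) : ContinuousAt (homNorm μ P) 0 := by
  rw [ContinuousAt, homNorm_zero, Metric.tendsto_nhds]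
  intro ε hε
  have hcont : Continuous fun z => quad P (dil n μ (-Real.log (ε / 2)) *ᵥ z) :=
    (continuous_quad P).comp (continuous_const.matrix_mulVec continuous_id)
  have hlt : ∀ᶠ z in 𝓝 (0 : Fin n → ℝ), quad P (dil n μ (-Real.log (ε / 2)) *ᵥ z) < 1 :=
    hcont.continuousAt.eventually_lt_const (by simp [quad_zero])
  filter_upwards [hlt] with z hq
  rw [Real.dist_0_eq_abs, abs_of_nonneg (homNorm_nonneg z)]
  rcases eq_or_ne z 0 with rfl | hz
  · rwa [homNorm_zero]
  · have hle := Real.exp_le_exp.2 ((h.homLog_le_iff hz).2 hq.le)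
    rw [← homNorm_eq_exp hz, Real.exp_log (by positivity)] at hle
    linarith

lemma continuous_homNorm (h : IsMonotoneDilation μ P) : Continuous (homNorm μ P) := by
  refine continuous_iff_continuousAt.2 fun z => ?_
  rcases eq_or_ne z 0 with rfl | hz
  · exact h.continuousAt_homNorm_zero
  · refine (h.contDiffAt_homLog hz).continuousAt.rexp.congr ?_
    filter_upwards [isOpen_compl_singleton.mem_nhds hz] with w hw
    exact (homNorm_eq_exp hw).symm

lemma exists_norm_homProj_le (h : IsMonotoneDilation μ P) :
    ∃ C > 0, ∀ z, ‖homProj μ P z‖ ≤ C := by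
  obtain ⟨C, hC, hle⟩ := exists_norm_le_of_quad_eq_one h.posDef
  refine ⟨C, hC, fun z => ?_⟩
  rcases eq_or_ne z 0 with rfl | hz
  · rw [homProj_zero, norm_zero]
    exact hC.le
  · exact hle _ (h.quad_homProj hz)

lemma exists_norm_le_mul_homNorm (h : IsMonotoneDilation μ P) (hμ : μ ≤ 0) :
    ∃ C > 0, ∀ z, homNorm μ P z ≤ 1 → ‖z‖ ≤ C * homNorm μ P z := by
  obtain ⟨C, hC, hle⟩ := h.exists_norm_homProj_le
  refine ⟨C, hC, fun z hz1 => ?_⟩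
  rcases eq_or_ne z 0 with rfl | hz
  · simp [homNorm_zero]
  · have hs : homLog μ P z ≤ 0 := Real.log_nonpos (homNorm_nonneg z) hz1
    calc ‖z‖ = ‖dil n μ (homLog μ P z) *ᵥ homProj μ P z‖ := by rw [dil_homLog_homProj]
      _ ≤ homNorm μ P z * ‖homProj μ P z‖ := by
        rw [homNorm_eq_exp hz]
        exact norm_dil_mulVec_le hμ hs _
      _ ≤ C * homNorm μ P z := by
        rw [mul_comm]
        exact mul_le_mul_of_nonneg_right (hle z) (homNorm_nonneg z)

/-- The formula comes from differentiating `quad P (d(-s(t)) x(t)) = 1`, `s = homLog μ P ∘ x`. -/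
lemma hasDerivAt_homLog_comp (h : IsMonotoneDilation μ P) {x : ℝ → Fin n → ℝ} {x' : Fin n → ℝ}
    {t : ℝ} (hx : HasDerivAt x x' t) (h0 : x t ≠ 0) :
    HasDerivAt (fun t => homLog μ P (x t))
      (((dil n μ (-homLog μ P (x t)) *ᵥ x') ⬝ᵥ (P *ᵥ homProj μ P (x t)) +
          homProj μ P (x t) ⬝ᵥ (P *ᵥ (dil n μ (-homLog μ P (x t)) *ᵥ x'))) /
        quad (P * generator n μ + generator n μ * P) (homProj μ P (x t))) t := by
  obtain ⟨s', hs⟩ : ∃ s', HasDerivAt (fun t => homLog μ P (x t)) s' t :=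
    ⟨_, ((h.contDiffAt_homLog h0).differentiableAt one_ne_zero).hasFDerivAt.comp_hasDerivAt t hx⟩
  have hq := hasDerivAt_quad P (hasDerivAt_dil_mulVec (μ := μ) hs.fun_neg hx)
  have hone : (fun t => quad P (dil n μ (-homLog μ P (x t)) *ᵥ x t)) =ᶠ[𝓝 t] fun _ => 1 := by
    filter_upwards [hx.continuousAt.eventually_ne h0] with r hr
    exact h.quad_homProj hr
  have hzero := (hq.congr_of_eventuallyEq hone.symm).unique (hasDerivAt_const t (1 : ℝ))
  have hG := mulVec_dotProduct_add_dotProduct_mulVec P (generator n μ) (homProj μ P (x t))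
  rw [generator_transpose] at hG
  refine hs.congr_deriv ?_
  rw [eq_div_iff (quad_pos h.posDef_generator (homProj_ne_zero h0)).ne', ← hG]
  simp only [← homProj_eq, add_dotProduct, smul_dotProduct, dotProduct_add, Matrix.mulVec_add,
    Matrix.mulVec_smul, dotProduct_smul, smul_eq_mul] at hzero
  linear_combination -hzero

end IsMonotoneDilation

end HomogeneousNorm

/-! ### The closed loop of one agent -/

section ClosedLoop

variable {n : ℕ} {μ lam : ℝ} {P : Matrix (Fin n) (Fin n) ℝ}

/-- The closed-loop vector field `z ↦ A z - ‖z‖_d ^ (1 + μ) K_lin d(-ln ‖z‖_d) z B`, which every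
component of the consensus error obeys. -/
noncomputable def agentField (μ lam : ℝ) (P : Matrix (Fin n) (Fin n) ℝ) (z : Fin n → ℝ) :
    Fin n → ℝ :=
  chainA n *ᵥ z + protocol μ lam P z • inputB n

/-- The quotient `yᵀ (P M + Mᵀ P) y / yᵀ (P G_d + G_d P) y` with `M = A - B K_lin`: the decay rate
of `ln ‖·‖_d` on the unit sphere. -/
noncomputable def decayRate (μ lam : ℝ) (P : Matrix (Fin n) (Fin n) ℝ) (y : Fin n → ℝ) : ℝ :=
  quad (P * closedLoopMatrix n lam + (closedLoopMatrix n lam)ᵀ * P) y /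
    quad (P * generator n μ + generator n μ * P) y

/-- A homogeneous closed loop of negative degree with the Lyapunov function `‖·‖_d`. -/
structure IsHomogeneousLoop (μ lam : ℝ) (P : Matrix (Fin n) (Fin n) ℝ) : Prop
    extends IsMonotoneDilation μ P where
  degree_neg : μ < 0
  lyapunov : (-(P * closedLoopMatrix n lam + (closedLoopMatrix n lam)ᵀ * P)).PosDef

/-- A continuous curve on `[0, τ]` that solves `x' = φ x` classically at the times at which it does
not vanish: the behaviour of Filippov solutions when `φ` is continuous except at the origin. -/
structure IsSolutionOffZero {E : Type*} [NormedAddCommGroup E] [NormedSpace ℝ E] (φ : E → E)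
    (τ : ℝ) (x : ℝ → E) : Prop where
  continuousOn : ContinuousOn x (Icc 0 τ)
  hasDerivAt : ∀ t ∈ Ioo 0 τ, x t ≠ 0 → HasDerivAt x (φ (x t)) t

lemma agentField_eq_sub (z : Fin n → ℝ) :
    agentField μ lam P z = chainA n *ᵥ z -
      homNorm μ P z ^ (1 + μ) • (gainLin n lam ⬝ᵥ homProj μ P z) • inputB n := by
  rw [agentField, protocol, neg_smul, ← sub_eq_add_neg, mul_smul]

lemma agentField_zero : agentField μ lam P (0 : Fin n → ℝ) = 0 := by
  simp [agentField_eq_sub, homProj_zero]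

lemma agentField_eq_dil {z : Fin n → ℝ} (hz : z ≠ 0) :
    agentField μ lam P z = Real.exp (μ * homLog μ P z) •
      dil n μ (homLog μ P z) *ᵥ (closedLoopMatrix n lam *ᵥ homProj μ P z) := by
  have hA : chainA n *ᵥ z = Real.exp (μ * homLog μ P z) •
      dil n μ (homLog μ P z) *ᵥ (chainA n *ᵥ homProj μ P z) := by
    rw [← chainA_mulVec_dil, dil_homLog_homProj]
  have hnorm : homNorm μ P z ^ (1 + μ) =
      Real.exp (μ * homLog μ P z) * Real.exp (homLog μ P z) := by
    rw [homNorm_eq_exp hz, ← Real.exp_mul, ← Real.exp_add]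
    ring_nf
  rw [agentField_eq_sub, hA, hnorm, closedLoopMatrix_mulVec, Matrix.mulVec_sub, Matrix.mulVec_smul,
    dil_mulVec_inputB, smul_sub, mul_smul, smul_comm (Real.exp (homLog μ P z))]

lemma dil_neg_homLog_agentField {z : Fin n → ℝ} (hz : z ≠ 0) :
    dil n μ (-homLog μ P z) *ᵥ agentField μ lam P z =
      Real.exp (μ * homLog μ P z) • (closedLoopMatrix n lam *ᵥ homProj μ P z) := by
  rw [agentField_eq_dil hz, Matrix.mulVec_smul, ← dil_add_mulVec, neg_add_cancel, dil_zero_mulVec]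

namespace IsMonotoneDilation

lemma agentField_neg (h : IsMonotoneDilation μ P) (z : Fin n → ℝ) :
    agentField μ lam P (-z) = -agentField μ lam P z := by
  rw [agentField_eq_sub, agentField_eq_sub, h.homNorm_neg, h.homProj_neg, Matrix.mulVec_neg,
    dotProduct_neg, neg_smul, smul_neg, neg_sub_neg, neg_sub]

lemma continuousOn_agentField (h : IsMonotoneDilation μ P) :
    ContinuousOn (agentField μ lam P) {0}ᶜ := by
  simp only [funext agentField_eq_sub]
  have hgain : Continuous fun y : Fin n → ℝ => (gainLin n lam ⬝ᵥ y) • inputB n :=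
    (continuous_const.dotProduct continuous_id).smul continuous_const
  have hnorm : ContinuousOn (fun z => homNorm μ P z ^ (1 + μ)) {0}ᶜ :=
    h.continuous_homNorm.continuousOn.rpow_const fun z hz => Or.inl (homNorm_pos hz).ne'
  exact (continuous_const.matrix_mulVec continuous_id).continuousOn.sub
    (hnorm.smul (hgain.comp_continuousOn h.continuousOn_homProj))

lemma continuousOn_decayRate (h : IsMonotoneDilation μ P) :
    ContinuousOn (decayRate μ lam P) {0}ᶜ :=
  (continuous_quad _).continuousOn.div (continuous_quad _).continuousOn
    fun _ hy => (quad_pos h.posDef_generator hy).ne'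

lemma hasDerivAt_homLog (h : IsMonotoneDilation μ P) {x : ℝ → Fin n → ℝ} {t : ℝ}
    (hx : HasDerivAt x (agentField μ lam P (x t)) t) (h0 : x t ≠ 0) :
    HasDerivAt (fun t => homLog μ P (x t))
      (Real.exp (μ * homLog μ P (x t)) * decayRate μ lam P (homProj μ P (x t))) t := by
  refine (h.hasDerivAt_homLog_comp hx h0).congr_deriv ?_
  rw [decayRate, ← mulVec_dotProduct_add_dotProduct_mulVec, dil_neg_homLog_agentField h0,
    Matrix.mulVec_smul, smul_dotProduct, dotProduct_smul, ← smul_add, smul_eq_mul, mul_div_assoc]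

lemma hasDerivAt_homProj (h : IsMonotoneDilation μ P) {x : ℝ → Fin n → ℝ} {t : ℝ}
    (hx : HasDerivAt x (agentField μ lam P (x t)) t) (h0 : x t ≠ 0) :
    HasDerivAt (fun t => homProj μ P (x t))
      (Real.exp (μ * homLog μ P (x t)) • (closedLoopMatrix n lam *ᵥ homProj μ P (x t)
        - decayRate μ lam P (homProj μ P (x t)) • (generator n μ *ᵥ homProj μ P (x t)))) t := by
  refine (hasDerivAt_dil_mulVec (h.hasDerivAt_homLog hx h0).fun_neg hx).congr_deriv ?_
  rw [dil_neg_homLog_agentField h0, ← homProj_eq, neg_smul, smul_sub, smul_smul, sub_eq_add_neg]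

/-- The factor `‖x‖_d ^ μ` in the equation of the radius is what the power `-μ` removes. -/
lemma hasDerivAt_homNorm_rpow (h : IsMonotoneDilation μ P) {x : ℝ → Fin n → ℝ} {t : ℝ}
    (hx : HasDerivAt x (agentField μ lam P (x t)) t) (h0 : x t ≠ 0) :
    HasDerivAt (fun t => homNorm μ P (x t) ^ (-μ))
      (-μ * decayRate μ lam P (homProj μ P (x t))) t := by
  have hexp := ((h.hasDerivAt_homLog hx h0).const_mul (-μ)).exp
  have hcancel : Real.exp (-μ * homLog μ P (x t)) * Real.exp (μ * homLog μ P (x t)) = 1 := by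
    rw [← Real.exp_add, neg_mul, neg_add_cancel, Real.exp_zero]
  refine (hexp.congr_deriv ?_).congr_of_eventuallyEq ?_
  · linear_combination (-μ * decayRate μ lam P (homProj μ P (x t))) * hcancel
  · filter_upwards [hx.continuousAt.eventually_ne h0] with r hr
    rw [homNorm_eq_exp hr, ← Real.exp_mul, mul_comm]

end IsMonotoneDilation

namespace IsHomogeneousLoop

lemma exists_decayRate_le (h : IsHomogeneousLoop μ lam P) :
    ∃ c > 0, ∀ y ≠ 0, decayRate μ lam P y ≤ -c := by
  obtain ⟨c, hc, hle⟩ := exists_quad_le_quad h.lyapunov (P * generator n μ + generator n μ * P)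
  refine ⟨c, hc, fun y hy => ?_⟩
  rw [decayRate, div_le_iff₀ (quad_pos h.posDef_generator hy)]
  linarith [neg_quad (P * closedLoopMatrix n lam + (closedLoopMatrix n lam)ᵀ * P) y, hle y]

lemma decayRate_neg (h : IsHomogeneousLoop μ lam P) {y : Fin n → ℝ} (hy : y ≠ 0) :
    decayRate μ lam P y < 0 := by
  obtain ⟨c, hc, hle⟩ := h.exists_decayRate_le
  linarith [hle y hy]

lemma exists_homNorm_rpow_add_le_of_forall_ne_zero (h : IsHomogeneousLoop μ lam P) :
    ∃ c > 0, ∀ ⦃τ x⦄, IsSolutionOffZero (agentField μ lam P) τ x → ∀ ⦃a b⦄, 0 ≤ a → a ≤ b →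
      b ≤ τ → (∀ t ∈ Ioo a b, x t ≠ 0) →
      homNorm μ P (x b) ^ (-μ) + c * (b - a) ≤ homNorm μ P (x a) ^ (-μ) := by
  obtain ⟨c, hc, hle⟩ := h.exists_decayRate_le
  have hμ : 0 < -μ := neg_pos.2 h.degree_neg
  refine ⟨-μ * c, mul_pos hμ hc, fun τ x hx a b ha hab hb h0 => ?_⟩
  have hcont : ContinuousOn (fun t => homNorm μ P (x t) ^ (-μ) + -μ * c * t) (Icc a b) :=
    ((h.continuous_homNorm.comp_continuousOn
      (hx.continuousOn.mono (Icc_subset_Icc ha hb))).rpow_const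
        fun _ _ => Or.inr hμ.le).add (by fun_prop)
  have hder : ∀ t ∈ interior (Icc a b),
      HasDerivWithinAt (fun t => homNorm μ P (x t) ^ (-μ) + -μ * c * t)
        (-μ * decayRate μ lam P (homProj μ P (x t)) + -μ * c) (interior (Icc a b)) t := by
    rw [interior_Icc]
    intro t ht
    have hxt := hx.hasDerivAt t ⟨ha.trans_lt ht.1, ht.2.trans_le hb⟩ (h0 t ht)
    exact ((h.hasDerivAt_homNorm_rpow hxt (h0 t ht)).fun_add
      (hasDerivAt_const_mul (-μ * c))).hasDerivWithinAt
  have hanti := antitoneOn_of_hasDerivWithinAt_nonpos (convex_Icc a b) hcont hder fun t ht => by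
    rw [interior_Icc] at ht
    nlinarith [hle _ (homProj_ne_zero (μ := μ) (P := P) (h0 t ht))]
  have hends := hanti (left_mem_Icc.2 hab) (right_mem_Icc.2 hab) hab
  simp only at hends
  linarith

lemma eq_zero_of_le (h : IsHomogeneousLoop μ lam P) {τ : ℝ} {x : ℝ → Fin n → ℝ}
    (hx : IsSolutionOffZero (agentField μ lam P) τ x) {a b : ℝ} (ha : 0 ≤ a) (hab : a ≤ b)
    (hb : b ≤ τ) (h0 : x a = 0) : x b = 0 := by
  obtain ⟨c, hc, hdec⟩ := h.exists_homNorm_rpow_add_le_of_forall_ne_zero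
  by_contra hxb
  have hclosed : IsClosed (Icc a b ∩ x ⁻¹' {0}) :=
    (hx.continuousOn.mono (Icc_subset_Icc ha hb)).preimage_isClosed_of_isClosed isClosed_Icc
      isClosed_singleton
  obtain ⟨r, ⟨⟨har, hrb⟩, hr0⟩, hlast⟩ := (isCompact_Icc.of_isClosed_subset hclosed
    inter_subset_left).exists_isGreatest ⟨a, left_mem_Icc.2 hab, h0⟩
  have hle := hdec hx (ha.trans har) hrb hb fun t ht ht0 =>
    (hlast ⟨⟨har.trans ht.1.le, ht.2.le⟩, ht0⟩).not_gt ht.1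
  rw [hr0, homNorm_zero, Real.zero_rpow (neg_pos.2 h.degree_neg).ne'] at hle
  have hpos : 0 < homNorm μ P (x b) ^ (-μ) := Real.rpow_pos_of_pos (homNorm_pos hxb) _
  nlinarith [mul_nonneg hc.le (sub_nonneg.2 hrb)]

lemma exists_homNorm_rpow_add_mul_le (h : IsHomogeneousLoop μ lam P) :
    ∃ c > 0, ∀ ⦃τ x⦄, IsSolutionOffZero (agentField μ lam P) τ x → ∀ t ∈ Icc 0 τ, x t ≠ 0 →
      homNorm μ P (x t) ^ (-μ) + c * t ≤ homNorm μ P (x 0) ^ (-μ) := by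
  obtain ⟨c, hc, hdec⟩ := h.exists_homNorm_rpow_add_le_of_forall_ne_zero
  refine ⟨c, hc, fun τ x hx t ht h0 => ?_⟩
  simpa using hdec hx le_rfl ht.1 ht.2 fun r hr hr0 =>
    h0 (h.eq_zero_of_le hx hr.1.le hr.2.le ht.2 hr0)

lemma homNorm_le_initial (h : IsHomogeneousLoop μ lam P) {τ : ℝ} {x : ℝ → Fin n → ℝ}
    (hx : IsSolutionOffZero (agentField μ lam P) τ x) {t : ℝ} (ht : t ∈ Icc 0 τ) :
    homNorm μ P (x t) ≤ homNorm μ P (x 0) := by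
  rcases eq_or_ne (x t) 0 with h0 | h0
  · rw [h0, homNorm_zero]
    exact homNorm_nonneg _
  · obtain ⟨c, hc, hdec⟩ := h.exists_homNorm_rpow_add_mul_le
    refine (Real.rpow_le_rpow_iff (homNorm_nonneg _) (homNorm_nonneg _)
      (neg_pos.2 h.degree_neg)).1 ?_
    nlinarith [hdec hx t ht h0, ht.1]

lemma exists_settlingTime (h : IsHomogeneousLoop μ lam P) :
    ∃ T : (Fin n → ℝ) → ℝ, ∀ ⦃τ x⦄, IsSolutionOffZero (agentField μ lam P) τ x →
      ∀ t ∈ Icc 0 τ, T (x 0) ≤ t → x t = 0 := by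
  obtain ⟨c, hc, hdec⟩ := h.exists_homNorm_rpow_add_mul_le
  refine ⟨fun z => homNorm μ P z ^ (-μ) / c, fun τ x hx t ht hT => ?_⟩
  by_contra h0
  have hpos : 0 < homNorm μ P (x t) ^ (-μ) := Real.rpow_pos_of_pos (homNorm_pos h0) _
  rw [div_le_iff₀' hc] at hT
  linarith [hdec hx t ht h0]

lemma matH_homProj_nonneg_of_initial (h : IsHomogeneousLoop μ lam P) (hlam : 0 ≤ lam) {τ : ℝ}
    {x : ℝ → Fin n → ℝ} (hx : IsSolutionOffZero (agentField μ lam P) τ x)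
    (h0 : 0 ≤ matH n lam *ᵥ homProj μ P (x 0)) {t : ℝ} (ht : t ∈ Icc 0 τ) :
    0 ≤ matH n lam *ᵥ homProj μ P (x t) := by
  rcases eq_or_ne (x t) 0 with hxt | hxt
  · rw [hxt, homProj_zero, Matrix.mulVec_zero]
  have hne : ∀ r ∈ Icc 0 t, x r ≠ 0 := fun r hr hr0 =>
    hxt (h.eq_zero_of_le hx hr.1 hr.2 ht.2 hr0)
  have hxc : ContinuousOn x (Icc 0 t) := hx.continuousOn.mono (Icc_subset_Icc le_rfl ht.2)
  have hs : ContinuousOn (fun r => homLog μ P (x r)) (Icc 0 t) :=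
    h.continuousOn_homLog.comp hxc hne
  have hy : ContinuousOn (fun r => homProj μ P (x r)) (Icc 0 t) :=
    h.continuousOn_homProj.comp hxc hne
  have hρ : ContinuousOn (fun r => decayRate μ lam P (homProj μ P (x r))) (Icc 0 t) :=
    h.continuousOn_decayRate.comp hy fun r hr => homProj_ne_zero (hne r hr)
  refine nonneg_of_hasDerivAt_metzler (ξ := fun r => matH n lam *ᵥ homProj μ P (x r))
    (a := fun r => Real.exp (μ * homLog μ P (x r)) •
      (closedLoopH n lam + -decayRate μ lam P (homProj μ P (x r)) • generatorH n μ lam))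
    ht.1 ?_ ?_ (fun r hr => ?_) (fun r hr => ?_) h0
  · exact (continuous_const.matrix_mulVec continuous_id).comp_continuousOn hy
  · exact (continuousOn_const.mul hs).rexp.smul
      (continuousOn_const.add (hρ.neg.smul continuousOn_const))
  · have hr' := hne r (Ioo_subset_Icc_self hr)
    refine (hasDerivAt_mulVec (matH n lam) (h.hasDerivAt_homProj
      (hx.hasDerivAt r ⟨hr.1, hr.2.trans_le ht.2⟩ hr') hr')).congr_deriv ?_
    rw [Matrix.mulVec_smul, Matrix.mulVec_sub, Matrix.mulVec_smul, matH_mulVec_closedLoopMatrix,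
      matH_mulVec_generator, Matrix.smul_mulVec, Matrix.add_mulVec, Matrix.smul_mulVec, neg_smul,
      sub_eq_add_neg]
  · have hrate : decayRate μ lam P (homProj μ P (x r)) < 0 :=
      h.decayRate_neg (homProj_ne_zero (hne r (Ioo_subset_Icc_self hr)))
    exact (isMetzler_closedLoopH.add ((isMetzler_generatorH h.degree_neg.le hlam).smul
      (neg_pos.2 hrate).le)).smul (Real.exp_pos _).le

end IsHomogeneousLoop

lemma IsMonotoneDilation.matH_homProj_nonneg_of_pNorm_le (h : IsMonotoneDilation μ P) (hμ : μ ≤ 0)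
    (hlam : 0 ≤ lam) {z : Fin n → ℝ} (hz : 0 ≤ matH n lam *ᵥ z) (hz1 : pNorm P z ≤ 1) :
    0 ≤ matH n lam *ᵥ homProj μ P z := by
  rcases eq_or_ne z 0 with rfl | h0
  · rw [homProj_zero, Matrix.mulVec_zero]
  have hs : homLog μ P z ≤ 0 := by
    rw [h.homLog_le_iff h0, neg_zero, dil_zero_mulVec]
    exact Real.sqrt_le_one.1 hz1
  have hd : ∀ r, HasDerivAt (fun r => matH n lam *ᵥ (dil n μ r *ᵥ z))
      (generatorH n μ lam *ᵥ (matH n lam *ᵥ (dil n μ r *ᵥ z))) r := fun r => by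
    refine (hasDerivAt_mulVec (matH n lam)
      (hasDerivAt_dil_mulVec (hasDerivAt_id r) (hasDerivAt_const r z))).congr_deriv ?_
    rw [← matH_mulVec_generator, Matrix.mulVec_zero, zero_add, one_smul, id]
  exact nonneg_of_hasDerivAt_metzler (ξ := fun r => matH n lam *ᵥ (dil n μ r *ᵥ z))
    (neg_nonneg.2 hs) (fun r _ => (hd r).continuousAt.continuousWithinAt) continuousOn_const
    (fun r _ => hd r) (fun _ _ => isMetzler_generatorH hμ hlam)
    (by simpa only [dil_zero_mulVec] using hz)

end ClosedLoop

/-! ### Integral curves and changes of time -/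

section IntegralCurve

variable {E : Type*} [NormedAddCommGroup E] [NormedSpace ℝ E]

open scoped Manifold in
lemma exists_integralCurve_of_hasCompactSupport [CompleteSpace E] {W : E → E}
    (hW : ContDiff ℝ 1 W) (hc : HasCompactSupport W) (x : E) :
    ∃ γ : ℝ → E, γ 0 = x ∧ ∀ t, HasDerivAt γ (W (γ t)) t := by
  obtain ⟨K, hK⟩ := hW.lipschitzWith_of_hasCompactSupport hc one_ne_zero
  obtain ⟨L, hL⟩ := hc.exists_bound_of_continuous hW.continuous
  have hloc : ∀ a : ℝ, ∃ γ : ℝ → E, γ 0 = x ∧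
      IsMIntegralCurveOn (I := 𝓘(ℝ, E)) γ W (Ioo (-a) a) := fun a => by
    have hpl : IsPicardLindelof (fun _ => W) (tmin := -|a|) (tmax := |a|)
        ⟨0, neg_nonpos.2 (abs_nonneg a), abs_nonneg a⟩ x (L.toNNReal * |a|.toNNReal) 0
        L.toNNReal K :=
      ⟨fun _ _ => hK.lipschitzOnWith, fun _ _ => continuousOn_const,
        fun _ _ y _ => (hL y).trans (Real.le_coe_toNNReal L), by simp⟩
    obtain ⟨γ, hγ0, hγ⟩ := hpl.exists_eq_forall_mem_Icc_hasDerivWithinAt₀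
    refine ⟨γ, hγ0, fun t ht => ?_⟩
    have hta : -|a| < t ∧ t < |a| := abs_lt.1 ((abs_lt.2 ht).trans_le (le_abs_self a))
    exact ((hγ t ⟨hta.1.le, hta.2.le⟩).hasDerivAt
      (Icc_mem_nhds hta.1 hta.2)).hasFDerivAt.hasMFDerivAt.hasMFDerivWithinAt
  obtain ⟨γ, hγ0, hγ⟩ := (exists_isMIntegralCurve_iff_exists_isMIntegralCurveOn_Ioo
    (I := 𝓘(ℝ, E)) (v := W) (contMDiff_vectorSpace_iff_contDiff.2 hW) x).2 hloc
  refine ⟨γ, hγ0, fun t => ?_⟩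
  have hderiv : HasFDerivAt γ ((1 : ℝ →L[ℝ] ℝ).smulRight (W (γ t))) t := (hγ t).hasFDerivAt
  simpa using hderiv.hasDerivAt

lemma exists_inverse_of_hasStrictDerivAt_pos {σ σ' : ℝ → ℝ}
    (hσ : ∀ r, HasStrictDerivAt σ (σ' r) r) (hpos : ∀ r, 0 < σ' r) (hbdd : BddAbove (range σ)) :
    ∃ (g : ℝ → ℝ) (T : ℝ), σ 0 < T ∧ g (σ 0) = 0 ∧
      (∀ t ∈ Ico (σ 0) T, HasDerivAt g (σ' (g t))⁻¹ t) ∧ Tendsto g (𝓝[<] T) atTop := by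
  have hmono : StrictMono σ := strictMono_of_hasDerivAt_pos (fun r => (hσ r).hasDerivAt) hpos
  have hcont : Continuous σ := continuous_iff_continuousAt.2 fun r => (hσ r).hasDerivAt.continuousAt
  have hinv : Function.LeftInverse (Function.invFun σ) σ :=
    Function.leftInverse_invFun hmono.injective
  have hlt : ∀ r, σ r < ⨆ q, σ q := fun r => (hmono (lt_add_one r)).trans_le (le_ciSup hbdd _)
  have hsurj : ∀ a, ∀ t ∈ Ico (σ a) (⨆ q, σ q), ∃ r, σ r = t := fun a t ht => by
    obtain ⟨r, hr⟩ := exists_lt_of_lt_ciSup ht.2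
    exact mem_range_of_exists_le_of_exists_ge hcont ⟨a, ht.1⟩ ⟨r, hr.le⟩
  refine ⟨Function.invFun σ, ⨆ q, σ q, hlt 0, hinv 0, fun t ht => ?_, tendsto_atTop.2 fun a => ?_⟩
  · obtain ⟨r, rfl⟩ := hsurj 0 t ht
    rw [hinv r]
    exact ((hσ r).to_local_left_inverse (hpos r).ne' (Eventually.of_forall hinv)).hasDerivAt
  · filter_upwards [Ico_mem_nhdsLT (hlt a)] with t ht
    obtain ⟨r, rfl⟩ := hsurj a t ht
    rw [hinv r]
    exact hmono.le_iff_le.1 ht.1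

lemma exists_trajectory_of_timeChange {φ : E → E} (hφ : φ 0 = 0) {X : ℝ → E} {σ σ' : ℝ → ℝ}
    (hσ : ∀ r, HasStrictDerivAt σ (σ' r) r) (hpos : ∀ r, 0 < σ' r) (hbdd : BddAbove (range σ))
    (hX : ∀ r, HasDerivAt X (σ' r • φ (X r)) r) (hlim : Tendsto X atTop (𝓝 0)) :
    ∃ (x : ℝ → E) (T : ℝ), x (σ 0) = X 0 ∧ ContinuousOn x (Ici (σ 0)) ∧
      ∀ t ∈ Ici (σ 0), t ≠ T → HasDerivAt x (φ (x t)) t := by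
  obtain ⟨g, T, hT, hg0, hg, hgT⟩ := exists_inverse_of_hasStrictDerivAt_pos hσ hpos hbdd
  let x : ℝ → E := fun t => if t < T then X (g t) else 0
  have hx_lt : ∀ t < T, x t = X (g t) := fun t ht => if_pos ht
  have hx_ge : ∀ t ≥ T, x t = 0 := fun t ht => if_neg (not_lt.2 ht)
  have hderiv : ∀ t ∈ Ici (σ 0), t ≠ T → HasDerivAt x (φ (x t)) t := by
    intro t ht htT
    rcases lt_or_gt_of_ne htT with hlt | hgt
    · have hchain := (hX (g t)).scomp t (hg t ⟨ht, hlt⟩)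
      rw [smul_smul, inv_mul_cancel₀ (hpos _).ne', one_smul, ← hx_lt t hlt] at hchain
      exact hchain.congr_of_eventuallyEq (eventually_lt_nhds hlt |>.mono hx_lt)
    · rw [hx_ge t hgt.le, hφ]
      exact (hasDerivAt_const t 0).congr_of_eventuallyEq
        (eventually_gt_nhds hgt |>.mono fun u hu => hx_ge u hu.le)
  have hcontT : ContinuousAt x T := by
    rw [ContinuousAt, hx_ge T le_rfl, ← nhdsLT_sup_nhdsGE]
    exact ((hlim.comp hgT).congr'
      (eventually_mem_nhdsWithin.mono fun t ht => (hx_lt t ht).symm)).sup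
      (tendsto_const_nhds.congr' (eventually_mem_nhdsWithin.mono fun t ht => (hx_ge t ht).symm))
  refine ⟨x, T, by rw [hx_lt _ hT, hg0], fun t ht => ContinuousAt.continuousWithinAt ?_, hderiv⟩
  rcases eq_or_ne t T with rfl | htT
  · exact hcontT
  · exact (hderiv t ht htT).continuousAt

end IntegralCurve

/-! ### Global solutions of the closed loop of one agent -/

section Existence

variable {n : ℕ} {μ lam : ℝ} {P : Matrix (Fin n) (Fin n) ℝ}

/-- The angular part of the closed loop, multiplied by `yᵀ (P G_d + G_d P) y` to make it polynomial
(a change of time). -/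
noncomputable def sphereField (μ lam : ℝ) (P : Matrix (Fin n) (Fin n) ℝ) (y : Fin n → ℝ) :
    Fin n → ℝ :=
  quad (P * generator n μ + generator n μ * P) y • (closedLoopMatrix n lam *ᵥ y) -
    quad (P * closedLoopMatrix n lam + (closedLoopMatrix n lam)ᵀ * P) y • (generator n μ *ᵥ y)

/-- A trajectory of the closed loop in polar coordinates `z = d(s) y`, `‖y‖_P = 1`, in the time
scale of `sphereField`. -/
structure IsPolarTrajectory (μ lam : ℝ) (P : Matrix (Fin n) (Fin n) ℝ) (y : ℝ → Fin n → ℝ)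
    (s : ℝ → ℝ) : Prop where
  quad_eq_one : ∀ r, quad P (y r) = 1
  hasDerivAt_angle : ∀ r, HasDerivAt y (sphereField μ lam P (y r)) r
  hasDerivAt_log : ∀ r, HasDerivAt s
    (quad (P * closedLoopMatrix n lam + (closedLoopMatrix n lam)ᵀ * P) (y r)) r

/-- The derivative of the original time with respect to the time scale of `sphereField`, at the
point with the polar coordinates `y`, `s`. -/
noncomputable def clockRate (μ : ℝ) (P : Matrix (Fin n) (Fin n) ℝ) (y : Fin n → ℝ) (s : ℝ) : ℝ :=
  quad (P * generator n μ + generator n μ * P) y * Real.exp (-μ * s)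

lemma contDiff_sphereField {m : WithTop ℕ∞} : ContDiff ℝ m (sphereField (n := n) μ lam P) :=
  ((contDiff_quad _).smul (closedLoopMatrix n lam).mulVecLin.toContinuousLinearMap.contDiff).sub
    ((contDiff_quad _).smul (generator n μ).mulVecLin.toContinuousLinearMap.contDiff)

lemma hasDerivAt_quad_smul_sphereField {y : ℝ → Fin n → ℝ} {c t : ℝ}
    (hy : HasDerivAt y (c • sphereField μ lam P (y t)) t) :
    HasDerivAt (fun t => quad P (y t)) 0 t := by
  refine (hasDerivAt_quad P hy).congr_deriv ?_
  have hM := mulVec_dotProduct_add_dotProduct_mulVec P (closedLoopMatrix n lam) (y t)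
  have hG := mulVec_dotProduct_add_dotProduct_mulVec P (generator n μ) (y t)
  rw [generator_transpose] at hG
  simp only [sphereField, ← hM, ← hG, smul_dotProduct, sub_dotProduct, dotProduct_sub,
    Matrix.mulVec_sub, Matrix.mulVec_smul, dotProduct_smul, smul_eq_mul]
  ring

namespace IsMonotoneDilation

lemma exists_sphereCurve (h : IsMonotoneDilation μ P) {y₀ : Fin n → ℝ} (hy₀ : quad P y₀ = 1) :
    ∃ y : ℝ → Fin n → ℝ, y 0 = y₀ ∧ (∀ t, quad P (y t) = 1) ∧
      ∀ t, HasDerivAt y (sphereField μ lam P (y t)) t := by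
  obtain ⟨C, hC, hle⟩ := exists_norm_le_of_quad_eq_one h.posDef
  let χ : ContDiffBump (0 : Fin n → ℝ) := ⟨C, C + 1, hC, lt_add_one C⟩
  obtain ⟨y, hy0, hy⟩ := exists_integralCurve_of_hasCompactSupport
    (χ.contDiff.smul (contDiff_sphereField (μ := μ) (lam := lam) (P := P)))
    χ.hasCompactSupport.smul_right y₀
  have hquad : ∀ t, HasDerivAt (fun t => quad P (y t)) 0 t := fun t =>
    hasDerivAt_quad_smul_sphereField (hy t)
  have hone : ∀ t, quad P (y t) = 1 := fun t => by
    rw [is_const_of_deriv_eq_zero (fun t => (hquad t).differentiableAt)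
      (fun t => (hquad t).deriv) t 0, hy0, hy₀]
  refine ⟨y, hy0, hone, fun t => (hy t).congr_deriv ?_⟩
  rw [Pi.smul_apply', χ.one_of_mem_closedBall (mem_closedBall_zero_iff.2 (hle _ (hone t))),
    one_smul]

lemma exists_polarTrajectory (h : IsMonotoneDilation μ P) {z : Fin n → ℝ} (hz : z ≠ 0) :
    ∃ y s, IsPolarTrajectory μ lam P y s ∧ dil n μ (s 0) *ᵥ y 0 = z := by
  obtain ⟨y, hy0, hone, hy⟩ := h.exists_sphereCurve (lam := lam) (h.quad_homProj hz)
  have hrate : Continuous fun r =>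
      quad (P * closedLoopMatrix n lam + (closedLoopMatrix n lam)ᵀ * P) (y r) :=
    (continuous_quad _).comp (continuous_iff_continuousAt.2 fun r => (hy r).continuousAt)
  refine ⟨y, fun r => homLog μ P z + ∫ u in (0 : ℝ)..r,
    quad (P * closedLoopMatrix n lam + (closedLoopMatrix n lam)ᵀ * P) (y u),
    ⟨hone, hy, fun r => (hrate.integral_hasStrictDerivAt 0 r).hasDerivAt.const_add _⟩, ?_⟩
  simp only [intervalIntegral.integral_same, add_zero, hy0, dil_homLog_homProj]

lemma measurable_homProj (h : IsMonotoneDilation μ P) : Measurable (homProj μ P) :=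
  measurable_of_continuousOn_compl_singleton 0 h.continuousOn_homProj

/-- Although `agentField` jumps at the origin when `μ = -1`, it is bounded near the origin. -/
lemma intervalIntegrable_agentField_comp (h : IsMonotoneDilation μ P) (hμ : -1 ≤ μ)
    {x : ℝ → Fin n → ℝ} {a b : ℝ} (hx : ContinuousOn x (uIcc a b)) :
    IntervalIntegrable (fun t => agentField μ lam P (x t)) volume a b := by
  obtain ⟨C, -, hC⟩ := h.exists_norm_homProj_le
  have hproj : IntegrableOn (fun t => homProj μ P (x t)) (uIoc a b) :=
    .of_bound (by simp [uIoc]) (h.measurable_homProj.comp_aemeasurable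
      ((hx.mono uIoc_subset_uIcc).aemeasurable measurableSet_uIoc)).aestronglyMeasurable C
      (Eventually.of_forall fun t => hC (x t))
  have hinput : IntervalIntegrable
      (fun t => (gainLin n lam ⬝ᵥ homProj μ P (x t)) • inputB n) volume a b := by
    rw [intervalIntegrable_iff, IntegrableOn]
    simpa [Matrix.vecMulVec_mulVec] using (Matrix.vecMulVec (inputB n)
      (gainLin n lam)).mulVecLin.toContinuousLinearMap.integrable_comp hproj
  have hnorm : ContinuousOn (fun t => homNorm μ P (x t) ^ (1 + μ)) (uIcc a b) :=
    (h.continuous_homNorm.comp_continuousOn hx).rpow_const fun _ _ => Or.inr (by linarith)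
  simp only [agentField_eq_sub]
  exact ((continuous_const.matrix_mulVec continuous_id).comp_continuousOn
    hx).intervalIntegrable.sub (hinput.continuousOn_smul hnorm)

end IsMonotoneDilation

namespace IsPolarTrajectory

variable {y : ℝ → Fin n → ℝ} {s : ℝ → ℝ}

lemma ne_zero (hys : IsPolarTrajectory μ lam P y s) (r : ℝ) : y r ≠ 0 := fun hr => by
  simpa [hr, quad_zero] using hys.quad_eq_one r

lemma clockRate_pos (hys : IsPolarTrajectory μ lam P y s) (h : IsMonotoneDilation μ P) (r : ℝ) :
    0 < clockRate μ P (y r) (s r) :=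
  mul_pos (quad_pos h.posDef_generator (hys.ne_zero r)) (Real.exp_pos _)

lemma continuous_clockRate (hys : IsPolarTrajectory μ lam P y s) :
    Continuous fun r => clockRate μ P (y r) (s r) := by
  have hy : Continuous y :=
    continuous_iff_continuousAt.2 fun r => (hys.hasDerivAt_angle r).continuousAt
  have hs : Continuous s :=
    continuous_iff_continuousAt.2 fun r => (hys.hasDerivAt_log r).continuousAt
  exact ((continuous_quad _).comp hy).mul (continuous_const.mul hs).rexp

lemma agentField_eq (hys : IsPolarTrajectory μ lam P y s) (h : IsMonotoneDilation μ P) (r : ℝ) :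
    agentField μ lam P (dil n μ (s r) *ᵥ y r) =
      Real.exp (μ * s r) • dil n μ (s r) *ᵥ (closedLoopMatrix n lam *ᵥ y r) := by
  have hback : dil n μ (-s r) *ᵥ (dil n μ (s r) *ᵥ y r) = y r := by
    rw [← dil_add_mulVec, neg_add_cancel, dil_zero_mulVec]
  have hlog : homLog μ P (dil n μ (s r) *ᵥ y r) = s r :=
    h.homLog_eq_of_quad_dil_eq_one (by rw [hback, hys.quad_eq_one])
  rw [agentField_eq_dil (dil_mulVec_eq_zero.not.2 (hys.ne_zero r)), homProj_eq, hlog, hback]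

lemma hasDerivAt_dil (hys : IsPolarTrajectory μ lam P y s) (h : IsMonotoneDilation μ P) (r : ℝ) :
    HasDerivAt (fun r => dil n μ (s r) *ᵥ y r)
      (clockRate μ P (y r) (s r) • agentField μ lam P (dil n μ (s r) *ᵥ y r)) r := by
  refine (hasDerivAt_dil_mulVec (hys.hasDerivAt_log r) (hys.hasDerivAt_angle r)).congr_deriv ?_
  have hclock : clockRate μ P (y r) (s r) * Real.exp (μ * s r) =
      quad (P * generator n μ + generator n μ * P) (y r) := by
    rw [clockRate, mul_assoc, ← Real.exp_add, neg_mul, neg_add_cancel, Real.exp_zero, mul_one]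
  rw [hys.agentField_eq h, smul_smul, hclock, sphereField, Matrix.mulVec_sub, Matrix.mulVec_smul,
    Matrix.mulVec_smul, dil_mulVec_generator, sub_add_cancel]

/-- With `c` the decay rate, `σ' = clockRate` and `μ < 0`, the function `e^{-μ s} - μ c σ`
decreases. -/
lemma bddAbove_range_clock (hys : IsPolarTrajectory μ lam P y s) (h : IsHomogeneousLoop μ lam P)
    {σ : ℝ → ℝ} (hσ : ∀ r, HasDerivAt σ (clockRate μ P (y r) (s r)) r) : BddAbove (range σ) := by
  obtain ⟨c, hc, hle⟩ := h.exists_decayRate_le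
  have hμc : 0 < -μ * c := mul_pos (neg_pos.2 h.degree_neg) hc
  have hanti : Antitone fun r => Real.exp (-μ * s r) + -μ * c * σ r := by
    refine antitone_of_hasDerivAt_nonpos (fun r =>
      ((hys.hasDerivAt_log r).const_mul (-μ)).exp.fun_add ((hσ r).const_mul (-μ * c))) fun r => ?_
    have hexp : 0 < -μ * Real.exp (-μ * s r) := mul_pos (neg_pos.2 h.degree_neg) (Real.exp_pos _)
    have hrate := (div_le_iff₀ (quad_pos h.posDef_generator (hys.ne_zero r))).1
      (hle _ (hys.ne_zero r))
    rw [clockRate, Pi.zero_apply]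
    nlinarith [mul_le_mul_of_nonneg_left hrate hexp.le]
  have hmono : Monotone σ :=
    (strictMono_of_hasDerivAt_pos hσ (hys.clockRate_pos h.toIsMonotoneDilation)).monotone
  refine ⟨(Real.exp (-μ * s 0) + -μ * c * σ 0) / (-μ * c), forall_mem_range.2 fun r => ?_⟩
  have hbound := hanti (le_max_right r 0)
  refine (hmono (le_max_left r 0)).trans ((le_div_iff₀' hμc).2 ?_)
  linarith [Real.exp_pos (-μ * s (max r 0))]

lemma tendsto_log_atBot (hys : IsPolarTrajectory μ lam P y s) (h : IsHomogeneousLoop μ lam P) :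
    Tendsto s atTop atBot := by
  obtain ⟨c, hc, hle⟩ := exists_quad_le_quad h.lyapunov P
  have hanti : Antitone fun r => s r + c * r := by
    refine antitone_of_hasDerivAt_nonpos
      (fun r => (hys.hasDerivAt_log r).fun_add (hasDerivAt_const_mul c)) fun r => ?_
    have hquad := hle (y r)
    rw [neg_quad, hys.quad_eq_one] at hquad
    rw [Pi.zero_apply]
    linarith
  have hlinear : Tendsto (fun r => s 0 - c * r) atTop atBot :=
    tendsto_atBot_add_const_left _ _
      (tendsto_neg_atTop_atBot.comp (tendsto_id.const_mul_atTop hc))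
  refine tendsto_atBot_mono' _ ((eventually_ge_atTop 0).mono fun r hr => ?_) hlinear
  have hle0 := hanti hr
  simp only [mul_zero, add_zero] at hle0
  linarith

lemma tendsto_dil (hys : IsPolarTrajectory μ lam P y s) (h : IsHomogeneousLoop μ lam P) :
    Tendsto (fun r => dil n μ (s r) *ᵥ y r) atTop (𝓝 0) := by
  obtain ⟨C, -, hle⟩ := exists_norm_le_of_quad_eq_one h.posDef
  have hs := hys.tendsto_log_atBot h
  have hexp : Tendsto (fun r => Real.exp (s r) * C) atTop (𝓝 0) := by
    simpa using (Real.tendsto_exp_atBot.comp hs).mul_const C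
  refine squeeze_zero_norm' ((hs.eventually_le_atBot 0).mono fun r hr => ?_) hexp
  refine (norm_dil_mulVec_le h.degree_neg.le hr (y r)).trans ?_
  gcongr
  exact hle _ (hys.quad_eq_one r)

end IsPolarTrajectory

namespace IsHomogeneousLoop

lemma exists_trajectory (h : IsHomogeneousLoop μ lam P) (z : Fin n → ℝ) :
    ∃ (x : ℝ → Fin n → ℝ) (T : ℝ), x 0 = z ∧ ContinuousOn x (Ici 0) ∧
      ∀ t ∈ Ici 0, t ≠ T → HasDerivAt x (agentField μ lam P (x t)) t := by
  rcases eq_or_ne z 0 with rfl | hz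
  · refine ⟨fun _ => 0, 0, rfl, continuousOn_const, fun t _ _ => ?_⟩
    rw [agentField_zero]
    exact hasDerivAt_const t 0
  obtain ⟨y, s, hys, hstart⟩ := h.exists_polarTrajectory (lam := lam) hz
  have hclock := hys.continuous_clockRate.integral_hasStrictDerivAt 0
  simpa only [intervalIntegral.integral_same, hstart] using
    exists_trajectory_of_timeChange agentField_zero hclock
      (hys.clockRate_pos h.toIsMonotoneDilation)
      (hys.bddAbove_range_clock h fun r => (hclock r).hasDerivAt)
      (hys.hasDerivAt_dil h.toIsMonotoneDilation) (hys.tendsto_dil h)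

lemma exists_integral_solution (h : IsHomogeneousLoop μ lam P) (hμ : -1 ≤ μ) (z : Fin n → ℝ) :
    ∃ x : ℝ → Fin n → ℝ, x 0 = z ∧ ∀ t ≥ 0,
      IntervalIntegrable (fun r => agentField μ lam P (x r)) volume 0 t ∧
      x t = x 0 + ∫ r in (0 : ℝ)..t, agentField μ lam P (x r) := by
  obtain ⟨x, T, hx0, hxc, hxd⟩ := h.exists_trajectory z
  refine ⟨x, hx0, fun t ht => ?_⟩
  have hxc_t : ContinuousOn x (Icc 0 t) := hxc.mono Icc_subset_Ici_self
  have hint : IntervalIntegrable (fun r => agentField μ lam P (x r)) volume 0 t :=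
    h.intervalIntegrable_agentField_comp hμ (by rwa [uIcc_of_le ht])
  refine ⟨hint, ?_⟩
  rw [integral_eq_of_hasDerivAt_off_countable_of_le x _ ht (countable_singleton T) hxc_t
    (fun r hr => hxd r hr.1.1.le hr.2) hint, add_sub_cancel]

end IsHomogeneousLoop

end Existence

/-! ### Filippov solutions of decoupled odd fields -/

section Filippov

variable {ι E : Type*} [NormedAddCommGroup E]

open Classical in
/-- The reflection of the components of `e'` in which `e` vanishes: averaging an odd field over it
cancels these components and keeps the others. -/
noncomputable def reflectZeros (e e' : ι → E) : ι → E := fun i => if e i = 0 then -e' i else e' i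

variable {φ : E → E}

lemma tendsto_midpoint_reflectZeros [NormedSpace ℝ E] (hφ : ContinuousOn φ {0}ᶜ)
    (hodd : ∀ z, φ (-z) = -φ z) (e : ι → E) :
    Tendsto (fun e' => midpoint ℝ (fun i => φ (e' i)) fun i => φ (reflectZeros e e' i)) (𝓝 e)
      (𝓝 fun i => φ (e i)) := by
  have hφ0 : φ 0 = 0 := by
    have hmid := midpoint_self_neg ℝ (φ 0)
    rwa [← hodd, neg_zero, midpoint_self] at hmid
  refine tendsto_pi_nhds.2 fun i => ?_
  simp only [pi_midpoint_apply]
  rcases eq_or_ne (e i) 0 with hi | hi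
  · simp [reflectZeros, hi, hodd, hφ0]
  · have hlim : Tendsto (fun e' : ι → E => φ (e' i)) (𝓝 e) (𝓝 (φ (e i))) :=
      (hφ.continuousAt (isOpen_compl_singleton.mem_nhds hi)).tendsto.comp
        (continuousAt_apply i e).tendsto
    simpa [reflectZeros, hi] using hlim

variable [Fintype ι]

lemma reflectZeros_mem_ball {e e' : ι → E} {δ : ℝ} (he' : e' ∈ Metric.ball e δ) :
    reflectZeros e e' ∈ Metric.ball e δ := by
  have hδ : 0 < δ := dist_nonneg.trans_lt he'
  rw [Metric.mem_ball, dist_pi_lt_iff hδ] at he' ⊢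
  intro i
  rcases eq_or_ne (e i) 0 with hi | hi
  · simpa [reflectZeros, hi] using he' i
  · simpa [reflectZeros, hi] using he' i

lemma measurePreserving_reflectZeros [MeasureSpace E] [MeasurableNeg E]
    [SigmaFinite (volume : Measure E)] [(volume : Measure E).IsNegInvariant] (e : ι → E) :
    MeasurePreserving (reflectZeros e) volume volume := by
  classical
  refine volume_preserving_pi (f := fun i (v : E) => if e i = 0 then -v else v) fun i => ?_
  split_ifs
  · exact Measure.measurePreserving_neg volume
  · exact MeasurePreserving.id volume

variable [NormedSpace ℝ E] [MeasureSpace E]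

lemma filippov_apply_eq {e g : ι → E} (hg : g ∈ filippov (fun e i => φ (e i)) e) {i : ι}
    (hi : ContinuousAt φ (e i)) : g i = φ (e i) := by
  refine eq_of_forall_dist_le fun ε hε => ?_
  obtain ⟨δ, hδ, hball⟩ := Metric.continuousAt_iff.1 hi ε hε
  have hconv : Convex ℝ {v : ι → E | v i ∈ Metric.closedBall (φ (e i)) ε} :=
    (convex_closedBall (φ (e i)) ε).linear_preimage (LinearMap.proj i : (ι → E) →ₗ[ℝ] E)
  have hclosed : IsClosed {v : ι → E | v i ∈ Metric.closedBall (φ (e i)) ε} :=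
    Metric.isClosed_closedBall.preimage (continuous_apply i)
  refine closure_minimal (convexHull_min ?_ hconv) hclosed
    (mem_iInter₂.1 (mem_iInter₂.1 hg δ hδ) ∅ measure_empty)
  rintro _ ⟨e', he', rfl⟩
  exact (hball ((dist_le_pi_dist e' e i).trans_lt he'.1)).le

lemma mem_filippov_of_odd [BorelSpace E] [SigmaFinite (volume : Measure E)]
    [(volume : Measure E).IsNegInvariant] [(volume : Measure E).IsOpenPosMeasure]
    (hφ : ContinuousOn φ {0}ᶜ) (hodd : ∀ z, φ (-z) = -φ z) (e : ι → E) :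
    (fun i => φ (e i)) ∈ filippov (fun e i => φ (e i)) e := by
  simp only [filippov, mem_iInter]
  intro δ hδ Z hZ
  refine mem_closure_iff_nhds.2 fun U hU => ?_
  have hnotMem : ∀ᵐ e', e' ∉ Z ∧ reflectZeros e e' ∉ Z :=
    (measure_eq_zero_iff_ae_notMem.1 hZ).and
      ((measurePreserving_reflectZeros e).quasiMeasurePreserving.ae
        (measure_eq_zero_iff_ae_notMem.1 hZ))
  obtain ⟨e', ⟨hZe', hZr⟩, hball, hmem⟩ := (Measure.dense_of_ae hnotMem).inter_nhds_nonempty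
    (inter_mem (Metric.ball_mem_nhds e hδ) (tendsto_midpoint_reflectZeros hφ hodd e hU))
  exact ⟨_, hmem, (convex_convexHull ℝ _).midpoint_mem
    (subset_convexHull ℝ _ ⟨e', ⟨hball, hZe'⟩, rfl⟩)
    (subset_convexHull ℝ _ ⟨_, ⟨reflectZeros_mem_ball hball, hZr⟩, rfl⟩)⟩

namespace IsSolutionOn

variable {f : E → E} {τ : ℝ}

lemma continuousOn {x : ℝ → E} (hx : IsSolutionOn f τ x) : ContinuousOn x (Icc 0 τ) := by
  obtain ⟨g, hg, -, hint⟩ := hx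
  exact (continuousOn_const.add ((intervalIntegral.continuousOn_primitive_interval' hg
    left_mem_uIcc).mono Icc_subset_uIcc)).congr hint

lemma hasDerivAt_clm {F : Type*} [NormedAddCommGroup F] [NormedSpace ℝ F] [CompleteSpace E]
    [CompleteSpace F] {x : ℝ → E} (hx : IsSolutionOn f τ x) (L : E →L[ℝ] F) {ψ : ℝ → F} {t : ℝ}
    (ht : t ∈ Ioo 0 τ) (hψ : ContinuousAt ψ t)
    (hL : ∀ᶠ r in 𝓝 t, ∀ v ∈ filippov f (x r), L v = ψ r) :
    HasDerivAt (fun r => L (x r)) (ψ t) t := by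
  obtain ⟨g, hg, hmem, hint⟩ := hx
  have hsub : ∀ r ∈ Icc 0 τ, IntervalIntegrable g volume 0 r := fun r hr =>
    hg.mono_set (uIcc_subset_uIcc_left (Icc_subset_uIcc hr))
  have hae : (fun r => L (g r)) =ᶠ[𝓝 t ⊓ ae volume] ψ := by
    filter_upwards [mem_inf_of_left hL, mem_inf_of_left (Icc_mem_nhds ht.1 ht.2),
      mem_inf_of_right ((ae_restrict_iff' measurableSet_Icc).1 hmem)] with r hLr hr hgr
    exact hLr _ (hgr hr)
  have hmeas : StronglyMeasurableAtFilter (fun r => L (g r)) (𝓝 t) :=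
    ⟨Ioc 0 τ, Ioc_mem_nhds ht.1 ht.2, L.continuous.comp_aestronglyMeasurable hg.1.1⟩
  have hgt := hsub t (Ioo_subset_Icc_self ht)
  have hderiv : HasDerivAt (fun r => L (x 0) + ∫ u in (0 : ℝ)..r, L (g u)) (ψ t) t :=
    (intervalIntegral.integral_hasDerivAt_of_tendsto_ae_right
      ⟨L.integrable_comp hgt.1, L.integrable_comp hgt.2⟩ hmeas
      ((hψ.tendsto.mono_left inf_le_left).congr' hae.symm)).const_add _
  refine hderiv.congr_of_eventuallyEq ?_
  filter_upwards [Icc_mem_nhds ht.1 ht.2] with r hr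
  rw [hint r hr, map_add, L.intervalIntegral_comp_comm (hsub r hr)]

lemma isSolutionOffZero_apply [CompleteSpace E] (hφ : ContinuousOn φ {0}ᶜ) {x : ℝ → ι → E}
    (hx : IsSolutionOn (fun e i => φ (e i)) τ x) (i : ι) :
    IsSolutionOffZero φ τ fun t => x t i := by
  have hcont : ContinuousOn (fun t => x t i) (Icc 0 τ) :=
    (continuous_apply i).comp_continuousOn hx.continuousOn
  refine ⟨hcont, fun t ht h0 => ?_⟩
  have hφt : ∀ {z}, z ≠ 0 → ContinuousAt φ z := fun hz =>
    hφ.continuousAt (isOpen_compl_singleton.mem_nhds hz)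
  have hxt : ContinuousAt (fun t => x t i) t := hcont.continuousAt (Icc_mem_nhds ht.1 ht.2)
  exact hx.hasDerivAt_clm (ContinuousLinearMap.proj i) ht
    (ContinuousAt.comp' (f := fun t => x t i) (hφt h0) hxt)
    ((hxt.eventually_ne h0).mono fun r hr v hv => filippov_apply_eq hv (hφt hr))

end IsSolutionOn

end Filippov

/-! ### The transmitted vectors -/

lemma weight_of_adj {N : ℕ} {G : Digraph (Fin (N + 1))} {i j : Fin (N + 1)} (hij : G.Adj i j) :
    weight G i j = 1 :=
  if_pos hij

lemma weight_nonneg {N : ℕ} (G : Digraph (Fin (N + 1))) (i j : Fin (N + 1)) :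
    0 ≤ weight G i j := by
  unfold weight
  split_ifs <;> norm_num

lemma eq_of_adj_of_sum_weight_eq_zero {N : ℕ} {G : Digraph (Fin (N + 1))} {d : Fin (N + 1) → ℝ}
    {i j : Fin (N + 1)} (hd : ∑ j, weight G i j • (d j - d i) = 0) (hmax : ∀ j, d j ≤ d i)
    (hij : G.Adj i j) : d j = d i := by
  have hterm := (Finset.sum_eq_zero_iff_of_nonpos fun k _ =>
    smul_nonpos_of_nonneg_of_nonpos (weight_nonneg G i k) (sub_nonpos.2 (hmax k))).1 hd j
      (Finset.mem_univ j)
  rwa [weight_of_adj hij, one_smul, sub_eq_zero] at hterm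

namespace IsLeaderFollower

variable {N n : ℕ} {G : Digraph (Fin (N + 1))}

lemma sum_weight_pos (hG : IsLeaderFollower G) {i : Fin (N + 1)} (hi : i ≠ 0) :
    0 < ∑ j, weight G i j := by
  obtain ⟨j, -, hij⟩ := Relation.TransGen.tail'_iff.1 (hG.reachable i hi)
  exact Finset.sum_pos' (fun k _ => weight_nonneg G i k)
    ⟨j, Finset.mem_univ j, by rw [weight_of_adj hij]; exact one_pos⟩

/-- The maximum propagates along edges, hence back to the leader. -/
lemma le_apply_zero_of_harmonic (hG : IsLeaderFollower G) {d : Fin (N + 1) → ℝ}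
    (hd : ∀ i, i ≠ 0 → ∑ j, weight G i j • (d j - d i) = 0) (i : Fin (N + 1)) : d i ≤ d 0 := by
  obtain ⟨k, hk⟩ := Finite.exists_max d
  have hadj : ∀ i j, G.Adj i j → d i = d k → d j = d k := fun i j hij hi => by
    have hi0 : i ≠ 0 := fun h0 => hG.leader_source j (h0 ▸ hij)
    rw [eq_of_adj_of_sum_weight_eq_zero (hd i hi0) (fun j => hi ▸ hk j) hij, hi]
  have hpath : ∀ i, Relation.TransGen (fun j i => G.Adj i j) 0 i → d i = d k → d 0 = d k := by
    intro i hi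
    induction hi with
    | single hij => exact hadj _ _ hij
    | tail _ hij ih => exact fun h => ih (hadj _ _ hij h)
  have hk0 : d 0 = d k := by
    rcases eq_or_ne k 0 with rfl | hk0
    · rfl
    · exact hpath k (hG.reachable k hk0) rfl
  exact hk0 ▸ hk i

lemma eq_apply_zero_of_harmonic (hG : IsLeaderFollower G) {d : Fin (N + 1) → Fin n → ℝ}
    (hd : ∀ i, i ≠ 0 → ∑ j, weight G i j • (d j - d i) = 0) (i : Fin (N + 1)) : d i = d 0 := by
  ext k
  have hdk : ∀ i, i ≠ 0 → ∑ j, weight G i j • (d j k - d i k) = 0 := fun i hi => by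
    simpa using congrFun (hd i hi) k
  refine le_antisymm (hG.le_apply_zero_of_harmonic (d := fun i => d i k) hdk i) ?_
  refine neg_le_neg_iff.1 (hG.le_apply_zero_of_harmonic (d := fun i => -d i k) (fun i hi => ?_) i)
  rw [← neg_eq_zero, ← Finset.sum_neg_distrib, ← hdk i hi]
  exact Finset.sum_congr rfl fun j _ => by rw [neg_sub_neg, ← smul_neg, neg_sub]

lemma isTransmitted_iff_harmonic (hG : IsLeaderFollower G) {x v : Fin (N + 1) → Fin n → ℝ} :
    IsTransmitted G x v ↔ v 0 = 0 ∧
      ∀ i, i ≠ 0 → ∑ j, weight G i j • ((v j - x j) - (v i - x i)) = 0 := by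
  refine and_congr_right fun _ => forall₂_congr fun i hi => ?_
  rw [one_div, eq_inv_smul_iff₀ (hG.sum_weight_pos hi).ne', Finset.sum_smul, eq_comm, ← sub_eq_zero,
    ← Finset.sum_sub_distrib]
  refine Eq.congr_left (Finset.sum_congr rfl fun j _ => ?_)
  rw [← smul_sub]
  congr 1
  abel

lemma isTransmitted_iff (hG : IsLeaderFollower G) {x v : Fin (N + 1) → Fin n → ℝ} :
    IsTransmitted G x v ↔ v = fun i => x i - x 0 := by
  rw [hG.isTransmitted_iff_harmonic]
  refine ⟨fun ⟨hv0, hv⟩ => funext fun i => ?_, ?_⟩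
  · have hconst := hG.eq_apply_zero_of_harmonic (d := fun i => v i - x i) hv i
    rw [hv0, zero_sub, sub_eq_iff_eq_add] at hconst
    rw [hconst, neg_add_eq_sub]
  · rintro rfl
    simp

lemma existsUnique_isTransmitted (hG : IsLeaderFollower G) (x : Fin (N + 1) → Fin n → ℝ) :
    ∃! v, IsTransmitted G x v :=
  ⟨fun i => x i - x 0, hG.isTransmitted_iff.2 rfl, fun _ => hG.isTransmitted_iff.1⟩

lemma isErrorField_agentField (hG : IsLeaderFollower G) (μ lam : ℝ)
    (P : Matrix (Fin n) (Fin n) ℝ) :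
    IsErrorField G μ lam P fun e i => agentField μ lam P (e i) := by
  rintro x _ hv
  obtain rfl := hG.isTransmitted_iff.1 hv
  funext i
  simp only [consensusError, agentVelocity, agentField, if_neg (Fin.succ_ne_zero i), if_true,
    zero_smul, add_zero, Matrix.mulVec_sub]
  abel

end IsLeaderFollower

/-! ### The error equation -/

section ErrorEquation

variable {n : ℕ} {μ lam : ℝ} {P : Matrix (Fin n) (Fin n) ℝ}

namespace IsMonotoneDilation

lemma isSolutionOffZero_error (h : IsMonotoneDilation μ P) {N : ℕ} {τ : ℝ}
    {x : ℝ → Fin N → Fin n → ℝ} (hx : IsSolutionOn (fun e i => agentField μ lam P (e i)) τ x)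
    (i : Fin N) : IsSolutionOffZero (agentField μ lam P) τ fun t => x t i :=
  hx.isSolutionOffZero_apply h.continuousOn_agentField i

lemma isHomogeneousCone_coneHom (h : IsMonotoneDilation μ P) (N : ℕ) (lam : ℝ) :
    IsHomogeneousCone μ (coneHom N μ lam P) := by
  refine ⟨⟨0, fun i => ?_⟩, fun e he s i => ?_⟩
  · rw [Pi.zero_apply, homProj_zero, Matrix.mulVec_zero]
  · rw [h.homProj_dil]
    exact he i

end IsMonotoneDilation

namespace IsHomogeneousLoop

lemma hasGlobalSolutions (h : IsHomogeneousLoop μ lam P) (hμ : -1 ≤ μ) (N : ℕ) :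
    HasGlobalSolutions fun (e : Fin N → Fin n → ℝ) i => agentField μ lam P (e i) := by
  intro e₀
  choose x hx0 hx using fun i => h.exists_integral_solution hμ (e₀ i)
  have hint : ∀ t ≥ 0, IntervalIntegrable
      (fun t (i : Fin N) => agentField μ lam P (x i t)) volume 0 t := fun t ht =>
    ⟨Integrable.of_eval fun i => (hx i t ht).1.1, Integrable.of_eval fun i => (hx i t ht).1.2⟩
  refine ⟨fun t i => x i t, funext hx0, fun τ hτ =>
    ⟨fun t i => agentField μ lam P (x i t), hint τ hτ.le, ?_, fun t ht => funext fun i => ?_⟩⟩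
  · exact .of_forall fun t => mem_filippov_of_odd h.continuousOn_agentField h.agentField_neg _
  · have hproj := (ContinuousLinearMap.proj (R := ℝ) (φ := fun _ : Fin N => Fin n → ℝ)
      i).intervalIntegral_comp_comm (hint t ht.1)
    exact (hx i t ht.1).2.trans (congrArg (x i 0 + ·) hproj)

lemma lyapunovStable (h : IsHomogeneousLoop μ lam P) (N : ℕ) :
    LyapunovStable fun (e : Fin N → Fin n → ℝ) i => agentField μ lam P (e i) := by
  intro ε hε
  obtain ⟨C, hC, hle⟩ := h.exists_norm_le_mul_homNorm h.degree_neg.le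
  have hsmall : ∀ᶠ z in 𝓝 (0 : Fin n → ℝ), homNorm μ P z < min 1 (ε / C) :=
    h.continuous_homNorm.continuousAt.eventually_lt_const (by
      rw [homNorm_zero]
      exact lt_min one_pos (div_pos hε hC))
  obtain ⟨δ, hδ, hball⟩ := Metric.eventually_nhds_iff_ball.1 hsmall
  refine ⟨δ, hδ, fun _ _ x hx hx0 t ht => (pi_norm_lt_iff hε).2 fun i => ?_⟩
  have hinit : homNorm μ P (x 0 i) < min 1 (ε / C) :=
    hball _ (mem_ball_zero_iff.2 ((norm_le_pi_norm (x 0) i).trans_lt hx0))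
  have hnorm := (h.homNorm_le_initial (h.isSolutionOffZero_error hx i) ht).trans_lt hinit
  rw [lt_min_iff, lt_div_iff₀' hC] at hnorm
  exact (hle _ hnorm.1.le).trans_lt hnorm.2

lemma globallyFiniteTimeStable (h : IsHomogeneousLoop μ lam P) (hμ : -1 ≤ μ) (N : ℕ) :
    GloballyFiniteTimeStable fun (e : Fin N → Fin n → ℝ) i => agentField μ lam P (e i) := by
  obtain ⟨T, hsettle⟩ := h.exists_settlingTime
  refine ⟨h.hasGlobalSolutions hμ N, h.lyapunovStable N, fun e => 1 + ∑ i, |T (e i)|,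
    fun e => by positivity, fun _ _ x hx t ht hTt => funext fun i => ?_⟩
  have hTi : |T (x 0 i)| ≤ ∑ i, |T (x 0 i)| :=
    Finset.single_le_sum (f := fun i => |T (x 0 i)|) (fun j _ => abs_nonneg _) (Finset.mem_univ i)
  exact hsettle (h.isSolutionOffZero_error hx i) t ht (by linarith [le_abs_self (T (x 0 i))])

lemma strictlyPositivelyInvariant_coneHom (h : IsHomogeneousLoop μ lam P) (hlam : 0 ≤ lam)
    (N : ℕ) :
    StrictlyPositivelyInvariant (fun (e : Fin N → Fin n → ℝ) i => agentField μ lam P (e i))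
      (coneHom N μ lam P) :=
  fun _ _ _ hx hx0 _ ht i =>
    h.matH_homProj_nonneg_of_initial hlam (h.isSolutionOffZero_error hx i) (hx0 i) ht

end IsHomogeneousLoop

lemma eta1_dotProduct_nonpos (hn : 0 < n) {z : Fin n → ℝ} (hz : 0 ≤ matH n lam *ᵥ z) :
    eta1 n ⬝ᵥ z ≤ 0 := by
  have h1 := hz ⟨0, hn⟩
  rwa [matH_mulVec_apply, chainRow_zero, Pi.zero_apply, neg_nonneg] at h1

lemma coneLin_subset_setSigma (N : ℕ) (hn : 0 < n) (lam : ℝ) : coneLin N n lam ⊆ setSigma N n :=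
  fun _ he i => eta1_dotProduct_nonpos hn (he i)

lemma coneHom_subset_setSigma (N : ℕ) (hn : 0 < n) (μ lam : ℝ) (P : Matrix (Fin n) (Fin n) ℝ) :
    coneHom N μ lam P ⊆ setSigma N n := by
  intro e he i
  have hproj := eta1_dotProduct_nonpos hn (he i)
  rw [eta1_dotProduct hn, homProj_eq, dil_mulVec_apply] at hproj
  rw [eta1_dotProduct hn]
  exact nonpos_of_mul_nonpos_right hproj (Real.exp_pos _)

end ErrorEquation

end NonOvershoot

theorem theorem3 (N n : ℕ) (hn : 1 ≤ n)
    (G : Digraph (Fin (N + 1))) (hG : IsLeaderFollower G)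
    (μ : ℝ) (hμ : μ ∈ Set.Ico (-1 : ℝ) 0) (lam : ℝ) (hlam : 0 < lam)
    (P : Matrix (Fin n) (Fin n) ℝ) (hP : P.PosDef)
    (hPG : (P * generator n μ + generator n μ * P).PosDef)
    (hPA : (-(P * closedLoopMatrix n lam + (closedLoopMatrix n lam)ᵀ * P)).PosDef) :
    -- the canonical homogeneous norm and the transmitted vectors are well defined
    (∀ z : Fin n → ℝ, z ≠ 0 → ∃! s : ℝ, pNorm P (dil n μ (-s) *ᵥ z) = 1) ∧
    (∀ x : Fin (N + 1) → Fin n → ℝ, ∃! v, IsTransmitted G x v) ∧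
    -- the closed-loop error equation, its finite-time stability and its invariant cone
    (∃ f : (Fin N → Fin n → ℝ) → (Fin N → Fin n → ℝ),
      IsErrorField G μ lam P f ∧
      GloballyFiniteTimeStable f ∧
      StrictlyPositivelyInvariant f (coneHom N μ lam P)) ∧
    -- the cones
    IsHomogeneousCone μ (coneHom N μ lam P) ∧
    coneLin N n lam ⊆ setSigma N n ∧
    coneHom N μ lam P ⊆ setSigma N n ∧
    (∀ e₀ ∈ coneLin N n lam, (∀ i, pNorm P (e₀ i) ≤ 1) → e₀ ∈ coneHom N μ lam P) := by
  have hm : IsMonotoneDilation μ P := ⟨hP, hPG⟩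
  have h : IsHomogeneousLoop μ lam P := ⟨hm, hμ.2, hPA⟩
  exact ⟨fun z hz => hm.existsUnique_pNorm_dil_eq_one hz, hG.existsUnique_isTransmitted,
    ⟨fun e i => agentField μ lam P (e i), hG.isErrorField_agentField μ lam P,
      h.globallyFiniteTimeStable hμ.1 N, h.strictlyPositivelyInvariant_coneHom hlam.le N⟩,
    hm.isHomogeneousCone_coneHom N lam, coneLin_subset_setSigma N hn lam,
    coneHom_subset_setSigma N hn μ lam P,
    fun _ he₀ hle i => hm.matH_homProj_nonneg_of_pNorm_le hμ.2.le hlam.le (he₀ i) (hle i)⟩
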